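/- Let $\Delta\subset\mathbb{R}^2$ be the Sierpiński triangle: $\Delta=\bigcap_{n\ge 0}\Delta_n$, where $\Delta_0$ is the closed equilateral triangle with vertices $v_1=(-\tfrac12,0)$, $v_2=(\tfrac12,0)$, $v_3=(0,\tfrac{\sqrt3}{2})$ and $\Delta_{n+1}=\bigcup_{i=1}^{3}\Psi_i(\Delta_n)$ with $\Psi_i(x)=\tfrac12(x+v_i)$. For $0<\alpha<1$ let $C_1^\alpha(\Delta)$ be the space of functions $f:\Delta\to\mathbb{R}$ with $|f(a)-f(b)|\le |a-b|^\alpha$ for all $a,b\in\Delta$, with the supremum metric. For $f\in C_1^\alpha(\Delta)$ put $$D_{\underline{B}*}^f(\Delta)=\sup\{d\ge 0:\ \lambda\{r\in\mathbb{R}:\ \underline{\dim}_B f^{-1}(r)\ge d\}>0\},$$ where $\lambda$ is Lebesgue measure on $\mathbb{R}$ and $\underline{\dim}_B A=\liminf_{\delta\to0+}\frac{\log N_\delta(A)}{\log(1/\delta)}$ is the lower box dimension ($N_\delta(A)$ being the least number of closed balls of radius $\delta$ centred in $A$ that cover $A$, and $\underline{\dim}_B\emptyset=0$). Let $$D_{\underline{B}*}(\alpha,\Delta)=\sup_{\mathcal{G}}\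 \inf_{f\in\mathcal{G}} D_{\underline{B}*}^f(\Delta),$$ the supremum being over all dense $G_\delta$ subsets $\mathcal{G}$ of $C_1^\alpha(\Delta)$. Then, for every $0<\alpha<1$, $$\frac{\frac{\alpha}{2}}{1+\frac{1+\log\frac{3}{\alpha}}{\log 2}+\frac{2}{\alpha}}\ \le\ D_{\underline{B}*}(\alpha,\Delta)\ \le\ 1-2^{-\alpha},$$ where $\log$ is the natural logarithm. -/

import Mathlib

open Filter Topology MeasureTheory
open scoped NNReal ENNReal

noncomputable section

/-- The lower box dimension `liminf_{δ → 0+} log N_δ(A) / log (1/δ)`, where `N_δ(A)` is the least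
number of closed balls of radius `δ` centred in `A` that cover `A`.
Passing to `ℝ≥0∞` only affects the empty set (`log 0 = ⊥`), whose dimension is thereby `0`. -/
def lowerBoxDim {X : Type*} [PseudoMetricSpace X] (A : Set X) : ℝ≥0∞ :=
  (liminf (fun δ : ℝ≥0 =>
      ENNReal.log (Metric.coveringNumber δ A : ℝ≥0∞) / ((Real.log (1 / (δ : ℝ)) : ℝ) : EReal))
    (𝓝[>] (0 : ℝ≥0))).toENNReal

/-- The set `C_c^α(M)` of `c`-Hölder-`α` functions on `M`. As a subspace of `C(M, ℝ)` for compact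
`M` it carries the topology of the supremum norm. -/
def holderFunctions (c α : ℝ) (M : Type*) [PseudoMetricSpace M] : Set C(M, ℝ) :=
  {f | ∀ a b : M, |f a - f b| ≤ c * dist a b ^ α}

/-- The essential supremum over `r` of the lower box dimension of the level sets `f⁻¹(r)`:
`sup {d : λ {r : lowerBoxDim (f⁻¹(r)) ≥ d} > 0}`. -/
def levelLowerBoxDim {M : Type*} [PseudoMetricSpace M] (f : C(M, ℝ)) : ℝ≥0∞ :=
  sSup {d : ℝ≥0∞ | 0 < volume {r : ℝ | d ≤ lowerBoxDim (f ⁻¹' {r})}}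

/-- The generic value: the supremum, over all dense `G_δ` subsets `𝒢` of the space of
1-Hölder-`α` functions on `M` with the supremum metric, of the infimum over `f ∈ 𝒢` of
`levelLowerBoxDim f`. -/
def genericLowerBoxDim (α : ℝ) (M : Type*) [PseudoMetricSpace M] [CompactSpace M] : ℝ≥0∞ :=
  ⨆ G ∈ {G : Set (holderFunctions 1 α M) | IsGδ G ∧ Dense G},
    ⨅ f ∈ G, levelLowerBoxDim (f : C(M, ℝ))

namespace Sierpinski

/-- The vertices of an equilateral triangle with unit sides. -/
def vertex : Fin 3 → EuclideanSpace ℝ (Fin 2) :=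
  ![!₂[-1 / 2, 0], !₂[1 / 2, 0], !₂[0, √3 / 2]]

/-- The similarity of ratio `1/2` that fixes the `i`-th vertex. -/
def contraction (i : Fin 3) (x : EuclideanSpace ℝ (Fin 2)) : EuclideanSpace ℝ (Fin 2) :=
  (1 / 2 : ℝ) • (x + vertex i)

/-- The `n`-th step of the construction, a union of `3 ^ n` closed triangles of side `2⁻ⁿ`. -/
def stage : ℕ → Set (EuclideanSpace ℝ (Fin 2))
  | 0 => convexHull ℝ (Set.range vertex)
  | n + 1 => ⋃ i : Fin 3, contraction i '' stage n

/-- The Sierpiński triangle. -/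
def triangle : Set (EuclideanSpace ℝ (Fin 2)) := ⋂ n : ℕ, stage n

theorem isCompact_stage (n : ℕ) : IsCompact (stage n) := by
  induction n with
  | zero => exact (Set.finite_range vertex).isCompact_convexHull ℝ
  | succ n ih =>
    refine isCompact_iUnion fun i => ih.image ?_
    unfold contraction
    fun_prop

instance compactSpace_triangle : CompactSpace triangle :=
  isCompact_iff_compactSpace.mp
    ((isCompact_stage 0).of_isClosed_subset
      (isClosed_iInter fun n => (isCompact_stage n).isClosed) (Set.iInter_subset _ 0))

end Sierpinski

end

/-! Lower bound: one dense G_δ set suffices, namely the open dense set of functions that separate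
two corners. Fix a level r and call a cell mixed if r separates the values at its corners; by
connectedness of the sides, a mixed cell meets the level set, so the number N of mixed cells of
level m bounds the covering number from below up to a constant. If a mixed cell has only one mixed
child, then r isolates the same corner in parent and child, and the address cannot turn to another
letter while this persists. Hence N grows by a factor of at least √2 per turn
(`two_pow_le_mixedCount`). Addresses with few turns are rare, and each accounts for levels of
measure O(2^(-αm)); a Chernoff bound and Borel–Cantelli (`ae_le_lowerBoxDim`) give, for almost every
r between the two corner values, at least 2dm turns in every mixed address, hence N ≥ 2^(dm). The
stated d satisfies the required inequality (`growth_lt_one`).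

Upper bound: every dense G_δ set must be met, so by Baire it suffices to find a residual set of
functions with thin level sets. With p = 2^(-α), any admissible function is approximated by one
that, near the corners of small cells, is an approximation of a singular function of one barycentric
coordinate, whose increments split in the ratio (1-p) : p over the halves of dyadic intervals
(`ramp`). Of the three children of a cell, one carries the upper part of the range (proportion p)
and the other two both carry the lower part (proportion 1-p). So for random r the number of cells
hit is 2 to a binomial variable with mean (1-p)j, and dimension 1-p follows
(`volume_levelCount_ge_le`). The weight p is the one that makes `ramp` uniformly α-Hölder. The hit
count is stable under small perturbations off a set of levels of small measure, so it passes to an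
open set (`dense_interior_sparse`). The Hölder constant 1 is kept by first passing to an exponent β
> α, which leaves room for the constants of the construction at small scales. -/

noncomputable section

/-! ### Barycentric coordinates and self-similarity of the triangle -/

namespace Sierpinski

/-- Barycentric coordinates with respect to the three vertices. -/
def bary (x : EuclideanSpace ℝ (Fin 2)) : Fin 3 → ℝ :=
  ![1 / 2 - x 0 - x 1 / √3, 1 / 2 + x 0 - x 1 / √3, 2 * x 1 / √3]

theorem sum_bary (x : EuclideanSpace ℝ (Fin 2)) : ∑ k, bary x k = 1 := by
  simp [bary, Fin.sum_univ_three]; ring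

theorem bary_vertex (i k : Fin 3) : bary (vertex i) k = if k = i then 1 else 0 := by
  have h3 : √3 ≠ 0 := by positivity
  fin_cases i <;> fin_cases k <;> simp [bary, vertex] <;> field_simp <;> norm_num

theorem bary_contraction (i k : Fin 3) (x : EuclideanSpace ℝ (Fin 2)) :
    bary (contraction i x) k = (bary x k + if k = i then 1 else 0) / 2 := by
  have h3 : √3 ≠ 0 := by positivity
  fin_cases i <;> fin_cases k <;> simp [bary, vertex, contraction] <;> field_simp <;> ring

theorem dist_sq_eq_bary (x y : EuclideanSpace ℝ (Fin 2)) :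
    dist x y ^ 2 = (∑ k, (bary x k - bary y k) ^ 2) / 2 := by
  have h3 : √3 ≠ 0 := by positivity
  have h : √3 ^ 2 = 3 := Real.sq_sqrt (by norm_num)
  rw [EuclideanSpace.dist_eq, Real.sq_sqrt (by positivity)]
  simp only [Fin.sum_univ_two, Fin.sum_univ_three, bary, Real.dist_eq, sq_abs]
  simp
  field_simp
  linear_combination 8 * (x 1 - y 1) ^ 2 * h

theorem bary_nonneg_of_mem_stage_zero {x : EuclideanSpace ℝ (Fin 2)} (hx : x ∈ stage 0)
    (k : Fin 3) : 0 ≤ bary x k := by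
  have hc : Convex ℝ {x : EuclideanSpace ℝ (Fin 2) | 0 ≤ bary x k} := by
    intro x hx y hy a b ha hb hab
    have : bary (a • x + b • y) k = a * bary x k + b * bary y k := by
      obtain rfl : b = 1 - a := by linarith
      fin_cases k <;> simp [bary] <;> ring
    simp only [Set.mem_ofPred_eq] at hx hy ⊢
    rw [this]
    positivity
  refine convexHull_min ?_ hc hx
  rintro _ ⟨i, rfl⟩
  simp only [Set.mem_ofPred_eq, bary_vertex]
  split_ifs <;> norm_num

theorem contraction_mem_stage_zero (i : Fin 3) {x : EuclideanSpace ℝ (Fin 2)} (hx : x ∈ stage 0) :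
    contraction i x ∈ stage 0 := by
  have hv : vertex i ∈ stage 0 := subset_convexHull _ _ ⟨i, rfl⟩
  have := (convex_convexHull ℝ (Set.range vertex)) hx hv (a := 1 / 2) (b := 1 / 2)
    (by norm_num) (by norm_num) (by norm_num)
  rwa [← smul_add] at this

theorem stage_succ_subset (n : ℕ) : stage (n + 1) ⊆ stage n := by
  induction n with
  | zero =>
    refine Set.iUnion_subset fun i => ?_
    rintro _ ⟨x, hx, rfl⟩
    exact contraction_mem_stage_zero i hx
  | succ n ih => exact Set.iUnion_mono fun i => Set.image_mono ih

theorem antitone_stage : Antitone stage := antitone_nat_of_succ_le stage_succ_subset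

theorem contraction_mem_triangle (i : Fin 3) {x : EuclideanSpace ℝ (Fin 2)} (hx : x ∈ triangle) :
    contraction i x ∈ triangle := by
  refine Set.mem_iInter.2 fun n => stage_succ_subset n ?_
  exact Set.mem_iUnion.2 ⟨i, x, Set.mem_iInter.1 hx n, rfl⟩

theorem contraction_injective (i : Fin 3) : Function.Injective (contraction i) := by
  intro x y h
  simpa [contraction] using h

/-- If the claim failed, each of the three maps would miss `x` from some stage on. As stages
decrease, all three would miss it at a common stage, against membership in the next one. -/
theorem exists_contraction_eq {x : EuclideanSpace ℝ (Fin 2)} (hx : x ∈ triangle) :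
    ∃ i, ∃ y ∈ triangle, contraction i y = x := by
  by_contra! hcon
  have h1 : ∀ i, ∃ n, x ∉ contraction i '' stage n := by
    intro i
    by_contra! h
    obtain ⟨y, -, hy⟩ := h 0
    refine hcon i y (Set.mem_iInter.2 fun n => ?_) hy
    obtain ⟨z, hz, hzx⟩ := h n
    rwa [← contraction_injective i (hzx.trans hy.symm)]
  choose n hn using h1
  obtain ⟨i, hi⟩ := Set.mem_iUnion.1 (Set.mem_iInter.1 hx (∑ i, n i + 1))
  exact hn i (Set.image_mono (antitone_stage (Finset.single_le_sum (fun _ _ => Nat.zero_le _)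
    (Finset.mem_univ i))) hi)

theorem lineMap_mem_stage (i j : Fin 3) (n : ℕ) :
    ∀ t ∈ Set.Icc (0 : ℝ) 1, AffineMap.lineMap (vertex i) (vertex j) t ∈ stage n := by
  induction n with
  | zero =>
    intro t ht
    exact (convex_convexHull ℝ (Set.range vertex)).lineMap_mem (subset_convexHull _ _ ⟨i, rfl⟩)
      (subset_convexHull _ _ ⟨j, rfl⟩) ht
  | succ n ih =>
    rintro t ⟨h0, h1⟩
    rcases le_total t (1 / 2) with h | h
    · refine Set.mem_iUnion.2 ⟨i, _, ih (2 * t) ⟨by linarith, by linarith⟩, ?_⟩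
      simp only [contraction, AffineMap.lineMap_apply_module]
      module
    · refine Set.mem_iUnion.2 ⟨j, _, ih (2 * t - 1) ⟨by linarith, by linarith⟩, ?_⟩
      simp only [contraction, AffineMap.lineMap_apply_module]
      module

/-- The cell maps of the Sierpiński triangle, as maps of the subtype. -/
def piece (i : Fin 3) (x : triangle) : triangle :=
  ⟨contraction i x, contraction_mem_triangle i x.2⟩

/-- The vertices, as points of the subtype. -/
def corner (i : Fin 3) : triangle :=
  ⟨vertex i, Set.mem_iInter.2 fun n => by
    simpa using lineMap_mem_stage i i n 0 ⟨le_rfl, zero_le_one⟩⟩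

/-- Barycentric coordinates on the subtype. -/
def coord (x : triangle) : Fin 3 → ℝ := bary x

theorem coord_nonneg (x : triangle) (k : Fin 3) : 0 ≤ coord x k :=
  bary_nonneg_of_mem_stage_zero (Set.mem_iInter.1 x.2 0) k

theorem sum_coord (x : triangle) : ∑ k, coord x k = 1 := sum_bary _

theorem coord_le_one (x : triangle) (k : Fin 3) : coord x k ≤ 1 := by
  rw [← sum_coord x]
  exact Finset.single_le_sum (fun i _ => coord_nonneg x i) (Finset.mem_univ k)

theorem coord_corner (i k : Fin 3) : coord (corner i) k = if k = i then 1 else 0 := bary_vertex i k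

theorem coord_piece (i k : Fin 3) (x : triangle) :
    coord (piece i x) k = (coord x k + if k = i then 1 else 0) / 2 := bary_contraction i k x

theorem dist_sq_eq (x y : triangle) :
    dist x y ^ 2 = (∑ k, (coord x k - coord y k) ^ 2) / 2 := dist_sq_eq_bary x y

theorem coord_injective : Function.Injective coord := by
  intro x y h
  have := dist_sq_eq x y
  simp only [h, sub_self, ne_eq, OfNat.ofNat_ne_zero, not_false_eq_true, zero_pow,
    Finset.sum_const_zero, zero_div, pow_eq_zero_iff, dist_eq_zero] at this
  exact this

theorem piece_corner_self (i : Fin 3) : piece i (corner i) = corner i := by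
  apply coord_injective
  ext k
  rw [coord_piece, coord_corner]
  split_ifs <;> norm_num

theorem piece_corner_comm (i j : Fin 3) : piece i (corner j) = piece j (corner i) := by
  apply coord_injective
  ext k
  rw [coord_piece, coord_piece, coord_corner, coord_corner]
  ring

theorem exists_piece_eq (x : triangle) : ∃ i y, piece i y = x := by
  obtain ⟨i, y, hy, h⟩ := exists_contraction_eq x.2
  exact ⟨i, ⟨y, hy⟩, Subtype.ext h⟩

theorem continuous_piece (i : Fin 3) : Continuous (piece i) := by
  unfold piece contraction
  fun_prop

theorem dist_coord_le (x y : triangle) : dist (coord x) (coord y) ≤ 2 * dist x y := by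
  refine (dist_pi_le_iff (by positivity)).2 fun k => ?_
  have h := dist_sq_eq x y
  have h1 : (coord x k - coord y k) ^ 2 ≤ ∑ k, (coord x k - coord y k) ^ 2 :=
    Finset.single_le_sum (f := fun k => (coord x k - coord y k) ^ 2)
      (fun i _ => sq_nonneg _) (Finset.mem_univ k)
  rw [Real.dist_eq]
  refine abs_le_of_sq_le_sq ?_ (by positivity)
  nlinarith [sq_nonneg (dist x y)]

theorem dist_le_dist_coord (x y : triangle) : dist x y ≤ 2 * dist (coord x) (coord y) := by
  have h := dist_sq_eq x y
  have h1 : ∀ k, (coord x k - coord y k) ^ 2 ≤ dist (coord x) (coord y) ^ 2 := by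
    intro k
    rw [← sq_abs (coord x k - coord y k), ← Real.dist_eq]
    gcongr
    exact dist_le_pi_dist _ _ k
  rw [Fin.sum_univ_three] at h
  refine le_of_sq_le_sq ?_ (by positivity)
  nlinarith [h1 0, h1 1, h1 2, sq_nonneg (dist (coord x) (coord y))]

theorem dist_le_one (x y : triangle) : dist x y ≤ 1 := by
  have h := dist_sq_eq x y
  have hx := sum_coord x
  have hy := sum_coord y
  rw [Fin.sum_univ_three] at h hx hy
  have h1 : ∀ z : triangle, ∀ k, coord z k ^ 2 ≤ coord z k := fun z k => by
    nlinarith [coord_nonneg z k, coord_le_one z k]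
  have h2 : ∀ k, 0 ≤ coord x k * coord y k := fun k =>
    mul_nonneg (coord_nonneg x k) (coord_nonneg y k)
  refine le_of_sq_le_sq ?_ zero_le_one
  nlinarith [h1 x 0, h1 x 1, h1 x 2, h1 y 0, h1 y 1, h1 y 2, h2 0, h2 1, h2 2]

theorem dist_coord_piece (i : Fin 3) (x y : triangle) :
    dist (coord (piece i x)) (coord (piece i y)) = dist (coord x) (coord y) / 2 := by
  have h : ∀ z, coord (piece i z) = (1 / 2 : ℝ) • (coord z + Pi.single i 1) := by
    intro z
    ext k
    rw [coord_piece]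
    simp [Pi.single_apply]
    ring
  rw [h, h, dist_smul₀, dist_add_right]
  norm_num
  ring

theorem dist_piece (i : Fin 3) (x y : triangle) : dist (piece i x) (piece i y) = dist x y / 2 := by
  refine (sq_eq_sq₀ dist_nonneg (by positivity)).1 ?_
  rw [dist_sq_eq, div_pow, dist_sq_eq]
  simp only [coord_piece, Fin.sum_univ_three]
  ring

/-- The sides of the large triangle survive every stage, so the intermediate value theorem applies
along them. -/
theorem exists_eq_of_corner_le {f : triangle → ℝ} (hf : Continuous f) {i j : Fin 3} {r : ℝ}
    (hi : f (corner i) ≤ r) (hj : r ≤ f (corner j)) : ∃ x, f x = r := by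
  let γ : Set.Icc (0 : ℝ) 1 → triangle := fun t =>
    ⟨AffineMap.lineMap (vertex i) (vertex j) (t : ℝ),
      Set.mem_iInter.2 fun n => lineMap_mem_stage i j n t t.2⟩
  have hγ : Continuous γ := by
    refine Continuous.subtype_mk ?_ _
    exact AffineMap.lineMap_continuous.comp continuous_subtype_val
  have h0 : γ 0 = corner i := Subtype.ext (by simp [γ, corner])
  have h1 : γ 1 = corner j := Subtype.ext (by simp [γ, corner])
  obtain ⟨t, ht⟩ := intermediate_value_univ (0 : Set.Icc (0 : ℝ) 1) 1 (hf.comp hγ)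
    (show r ∈ Set.Icc _ _ from ⟨by simpa [h0] using hi, by simpa [h1] using hj⟩)
  exact ⟨γ t, ht⟩

/-- The composition of the cell maps along a word. -/
def cell : List (Fin 3) → triangle → triangle
  | [] => id
  | i :: u => piece i ∘ cell u

@[simp] theorem cell_nil : cell [] = id := rfl

@[simp] theorem cell_cons (i : Fin 3) (u : List (Fin 3)) : cell (i :: u) = piece i ∘ cell u := rfl

theorem cell_append (u v : List (Fin 3)) : cell (u ++ v) = cell u ∘ cell v := by
  induction u with
  | nil => rfl
  | cons i u ih => simp [ih, Function.comp_assoc]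

theorem continuous_cell (u : List (Fin 3)) : Continuous (cell u) := by
  induction u with
  | nil => exact continuous_id
  | cons i u ih => exact (continuous_piece i).comp ih

theorem dist_cell (u : List (Fin 3)) (x y : triangle) :
    dist (cell u x) (cell u y) = dist x y / 2 ^ u.length := by
  induction u with
  | nil => simp
  | cons i u ih => simp [dist_piece, ih, pow_succ, div_div]

theorem exists_cell_eq (m : ℕ) (x : triangle) : ∃ u : List (Fin 3), u.length = m ∧
    ∃ y, cell u y = x := by
  induction m generalizing x with
  | zero => exact ⟨[], rfl, x, rfl⟩
  | succ m ih =>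
    obtain ⟨i, y, rfl⟩ := exists_piece_eq x
    obtain ⟨u, hu, z, rfl⟩ := ih y
    exact ⟨i :: u, by simp [hu], z, rfl⟩

/-- The words of length `m` over the alphabet `Fin 3`. -/
def words : ℕ → Finset (List (Fin 3))
  | 0 => {[]}
  | m + 1 => (Finset.univ ×ˢ words m).map
      ⟨fun p => p.1 :: p.2, fun p q h => by simpa [Prod.ext_iff] using h⟩

@[simp] theorem mem_words {m : ℕ} {u : List (Fin 3)} : u ∈ words m ↔ u.length = m := by
  induction m generalizing u with
  | zero => simp [words]
  | succ m ih =>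
    cases u with
    | nil => simp [words]
    | cons i u => simp [words, ih, DFunLike.coe]

theorem sum_words_succ {M : Type*} [AddCommMonoid M] (m : ℕ) (F : List (Fin 3) → M) :
    ∑ u ∈ words (m + 1), F u = ∑ i, ∑ u ∈ words m, F (i :: u) := by
  rw [words, Finset.sum_map, Finset.sum_product]
  rfl

theorem card_words (m : ℕ) : (words m).card = 3 ^ m := by
  induction m with
  | zero => rfl
  | succ m ih => simp [words, ih, pow_succ, mul_comm]

theorem card_filter_words_succ (m : ℕ) (P : List (Fin 3) → Prop) [DecidablePred P] :
    ((words (m + 1)).filter P).card = ∑ i, ((words m).filter fun u => P (i :: u)).card := by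
  simp only [Finset.card_filter]
  exact sum_words_succ m _

/-! ### Mixed cells and changes of letter -/

/-- A set of points separates the three corners. -/
def Mixed (c : triangle → Prop) : Prop := ∃ i j, c (corner i) ∧ ¬ c (corner j)

/-- The corner `i` is separated by `c` from the two other corners. -/
def Isolates (c : triangle → Prop) (i : Fin 3) : Prop :=
  ∀ j, j ≠ i → (c (corner j) ↔ ¬ c (corner i))

theorem Isolates.unique {c : triangle → Prop} {i j : Fin 3} (hi : Isolates c i)
    (hj : Isolates c j) : i = j := by
  by_contra hij
  obtain ⟨k, hki, hkj⟩ : ∃ k : Fin 3, k ≠ i ∧ k ≠ j := by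
    clear hi hj
    revert i j; decide
  have h1 := hi k hki
  have h2 := hj k hkj
  have h3 := hi j (Ne.symm hij)
  tauto

theorem not_mixed_iff {c : triangle → Prop} :
    ¬ Mixed c ↔ ∀ i j, c (corner i) ↔ c (corner j) := by
  constructor
  · intro h i j
    by_contra hij
    apply h
    by_cases hi : c (corner i)
    · exact ⟨i, j, hi, fun hj => hij (by tauto)⟩
    · exact ⟨j, i, by tauto, hi⟩
  · rintro h ⟨i, j, hi, hj⟩
    exact hj ((h i j).1 hi)

theorem Mixed.of_isolates {c : triangle → Prop} {i : Fin 3} (h : Isolates c i) : Mixed c := by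
  by_contra hc
  rw [not_mixed_iff] at hc
  obtain ⟨j, hj⟩ : ∃ j : Fin 3, j ≠ i := exists_ne i
  have := h j hj
  have := hc i j
  tauto

theorem exists_others (i : Fin 3) : ∃ j k : Fin 3, j ≠ i ∧ k ≠ i ∧ ∀ l, l = i ∨ l = j ∨ l = k := by
  revert i; decide

/-- Think of `P a` as the state of corner `a` and of `Q a b` as that of the midpoint of side `ab`.
The two pieces other than `i` share a midpoint, so all their corners have one state, and corner `i`
alone has the other. -/
theorem forall_iff_not_of_unique {P : Fin 3 → Prop} {Q : Fin 3 → Fin 3 → Prop}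
    (hcomm : ∀ a b, Q a b ↔ Q b a) (hself : ∀ a, Q a a ↔ P a) {i : Fin 3}
    (hP : ¬ ∀ a b, P a ↔ P b) (h : ∀ k, k ≠ i → ∀ a b, Q k a ↔ Q k b) :
    (∀ l, l ≠ i → (P l ↔ ¬ P i)) ∧ ∀ l, l ≠ i → (Q i l ↔ ¬ Q i i) := by
  obtain ⟨j, k, hj, hk, hall⟩ := exists_others i
  have hjk : P j ↔ P k :=
    (hself j).symm.trans (((h j hj j k).trans (hcomm j k)).trans ((h k hk j k).trans (hself k)))
  have hne : ¬ (P j ↔ P i) := by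
    intro hji
    have hi : ∀ a, P a ↔ P i := by
      intro a
      obtain rfl | rfl | rfl := hall a
      · exact Iff.rfl
      · exact hji
      · exact hjk.symm.trans hji
    exact hP fun a b => (hi a).trans (hi b).symm
  have hP' : ∀ l, l ≠ i → (P l ↔ P j) := by
    intro l hl
    obtain rfl | rfl | rfl := hall l
    · exact absurd rfl hl
    · exact Iff.rfl
    · exact hjk.symm
  refine ⟨fun l hl => ?_, fun l hl => ?_⟩
  · have := hP' l hl
    tauto
  · have h1 := hP' l hl
    have h2 := (hcomm i l).trans ((h l hl i l).trans (hself l))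
    have h3 := hself i
    tauto

theorem isolates_of_unique_piece {c : triangle → Prop} (hc : Mixed c) {i : Fin 3}
    (h : ∀ k, k ≠ i → ¬ Mixed (c ∘ piece k)) :
    Isolates c i ∧ Isolates (c ∘ piece i) i :=
  forall_iff_not_of_unique (P := fun a => c (corner a)) (Q := fun a b => c (piece a (corner b)))
    (fun a b => by rw [piece_corner_comm]) (fun a => by rw [piece_corner_self])
    (fun h => not_mixed_iff.2 h hc) (fun k hk => not_mixed_iff.1 (h k hk))

/-- The number of changes of letter in the word `q :: u`. -/
def turns : Fin 3 → List (Fin 3) → ℕ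
  | _, [] => 0
  | q, i :: u => (if i = q then 0 else 1) + turns i u

open Classical in
/-- The number of cells of level `m` with corners separated by `c`. -/
def mixedCount (m : ℕ) (c : triangle → Prop) : ℕ :=
  ((words m).filter fun u => Mixed (c ∘ cell u)).card

theorem mixedCount_succ (m : ℕ) (c : triangle → Prop) :
    mixedCount (m + 1) c = ∑ i, mixedCount m (c ∘ piece i) := by
  classical
  rw [mixedCount, card_filter_words_succ]
  rfl

theorem mixedCount_piece_le (m : ℕ) (c : triangle → Prop) (i : Fin 3) :
    mixedCount m (c ∘ piece i) ≤ mixedCount (m + 1) c := by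
  rw [mixedCount_succ]
  exact Finset.single_le_sum (f := fun i => mixedCount m (c ∘ piece i))
    (fun _ _ => Nat.zero_le _) (Finset.mem_univ i)

theorem mixedCount_add_le (m : ℕ) (c : triangle → Prop) {i j : Fin 3} (hij : i ≠ j) :
    mixedCount m (c ∘ piece i) + mixedCount m (c ∘ piece j) ≤ mixedCount (m + 1) c := by
  rw [mixedCount_succ, ← Finset.sum_pair (f := fun i => mixedCount m (c ∘ piece i)) hij]
  exact Finset.sum_le_sum_of_subset (Finset.subset_univ _)

/-- Induction on the level. A turn is free of branching only when the current letter is not the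
isolated corner, and it then makes it so; the second, stronger bound records that state. Thus at
most one of two consecutive turns avoids branching, whence the square. -/
theorem two_pow_le_mixedCount (m : ℕ) (c : triangle → Prop) (q : Fin 3) (k : ℕ) (hc : Mixed c)
    (h : ∀ u : List (Fin 3), u.length = m → Mixed (c ∘ cell u) → k ≤ turns q u) :
    2 ^ k ≤ 2 * mixedCount m c ^ 2 ∧ (Isolates c q → 2 ^ k ≤ mixedCount m c ^ 2) := by
  induction m generalizing c q k with
  | zero =>
    have hk : k = 0 := by simpa [turns] using h [] rfl (by simpa using hc)
    have h1 : mixedCount 0 c = 1 := by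
      rw [mixedCount, words, Finset.filter_singleton, if_pos (by simpa using hc)]
      rfl
    subst hk
    simp [h1]
  | succ m ih =>
    have hstep : ∀ i, Mixed (c ∘ piece i) → ∀ k', (i = q → k' ≤ k) → (i ≠ q → k' ≤ k - 1) →
        2 ^ k' ≤ 2 * mixedCount m (c ∘ piece i) ^ 2 ∧
        (Isolates (c ∘ piece i) i → 2 ^ k' ≤ mixedCount m (c ∘ piece i) ^ 2) := by
      intro i hi k' h1 h2
      refine ih (c ∘ piece i) i k' hi fun u hu hm => ?_
      have h3 := h (i :: u) (by simp [hu]) hm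
      rw [turns] at h3
      by_cases hiq : i = q
      · have := h1 hiq
        rw [if_pos hiq] at h3
        omega
      · have := h2 hiq
        rw [if_neg hiq] at h3
        omega
    have hpow : 2 ^ k ≤ 2 * 2 ^ (k - 1) := by
      rw [← pow_succ']
      exact Nat.pow_le_pow_right two_pos (by omega)
    -- Two mixed children double the smaller count: the gain of 4 in the square pays for one turn
    -- and for the factor 2.
    by_cases hsplit : ∃ i j, i ≠ j ∧ Mixed (c ∘ piece i) ∧ Mixed (c ∘ piece j)
    · obtain ⟨i, j, hij, hi, hj⟩ := hsplit
      have hadd := mixedCount_add_le m c hij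
      suffices 2 ^ k ≤ mixedCount (m + 1) c ^ 2 from ⟨by omega, fun _ => this⟩
      have h1 := (hstep i hi (k - 1) (by omega) (by omega)).1
      have h2 := (hstep j hj (k - 1) (by omega) (by omega)).1
      have h3 := Nat.pow_le_pow_left hadd 2
      rcases le_total (mixedCount m (c ∘ piece i)) (mixedCount m (c ∘ piece j)) with h | h <;>
        nlinarith
    · push Not at hsplit
      obtain ⟨i, hi⟩ : ∃ i, Mixed (c ∘ piece i) := by
        by_contra! hno
        exact hno 0 (Mixed.of_isolates (isolates_of_unique_piece hc fun k _ => hno k).2)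
      have hiso := isolates_of_unique_piece hc (i := i) fun j hj hm => hsplit i j hj.symm hi hm
      have hle := Nat.pow_le_pow_left (mixedCount_piece_le m c i) 2
      constructor
      · have h1 := (hstep i hi (k - 1) (by omega) (by omega)).2 hiso.2
        omega
      · intro hq
        have hiq := hiso.1.unique hq
        have h1 := (hstep i hi k (by omega) (fun h => absurd hiq h)).2 hiso.2
        omega

end Sierpinski

/-! ### Lower box dimension through dyadic scales -/

theorem tendsto_half_pow_nhdsGT_zero :
    Tendsto (fun m : ℕ => (1 / 2 : ℝ≥0) ^ m) atTop (𝓝[>] 0) :=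
  tendsto_nhdsWithin_iff.2 ⟨NNReal.tendsto_pow_atTop_nhds_zero_of_lt_one (by norm_num),
    Eventually.of_forall fun m => by simp⟩

theorem EReal.toENNReal_coe_real (d : ℝ) : (d : EReal).toENNReal = ENNReal.ofReal d := by
  rw [EReal.toENNReal_of_ne_top (EReal.coe_ne_top d), EReal.toReal_coe]

/-- Covering numbers are antitone in the radius, so passing from δ to the dyadic radius just above
it costs at most a factor 2^d. Together with `K` this is absorbed by any exponent `x < d` once δ is
small. -/
theorem le_lowerBoxDim_of_eventually {X : Type*} [PseudoMetricSpace X] {A : Set X} {d K : ℝ}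
    (hd : 0 < d) (hK : 0 < K)
    (h : ∀ᶠ m : ℕ in atTop,
      ENNReal.ofReal ((2 ^ m) ^ d / K) ≤ Metric.coveringNumber ((1 / 2 : ℝ≥0) ^ m) A) :
    ENNReal.ofReal d ≤ lowerBoxDim A := by
  rw [← EReal.toENNReal_coe_real, lowerBoxDim]
  refine EReal.toENNReal_le_toENNReal (EReal.ge_of_forall_gt_iff_ge.1 fun x hx => ?_)
  have hx : x < d := by exact_mod_cast hx
  obtain ⟨M, hM⟩ := eventually_atTop.1 h
  refine le_liminf_of_le (h := ?_)
  have hlog : Tendsto (fun δ : ℝ≥0 => Real.log (1 / (δ : ℝ))) (𝓝[>] 0) atTop := by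
    have h1 : Tendsto (fun δ : ℝ≥0 => (δ : ℝ)) (𝓝[>] 0) (𝓝[>] 0) :=
      tendsto_nhdsWithin_iff.2 ⟨(NNReal.continuous_coe.tendsto' 0 0 rfl).mono_left
        nhdsWithin_le_nhds, by filter_upwards [self_mem_nhdsWithin] with δ hδ using hδ⟩
    simp only [one_div]
    exact Real.tendsto_log_atTop.comp (tendsto_inv_nhdsGT_zero.comp h1)
  have hsmall : ∀ᶠ δ : ℝ≥0 in 𝓝[>] 0, δ < (1 / 2) ^ (M + 1) :=
    nhdsWithin_le_nhds (Iio_mem_nhds (by positivity))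
  filter_upwards [self_mem_nhdsWithin, hsmall, hlog.eventually_gt_atTop 0,
    hlog.eventually_ge_atTop ((d * Real.log 2 + Real.log K) / (d - x))] with δ hδ0 hδ hl0 hl
  have hδ0 : 0 < δ := hδ0
  rw [EReal.le_div_iff_mul_le (by exact_mod_cast hl0) (EReal.coe_ne_top _)]
  obtain ⟨m, hm1, hm2⟩ := exists_nat_pow_near_of_lt_one hδ0
    (hδ.le.trans (pow_le_one₀ (by norm_num) (by norm_num)))
    (show (0 : ℝ≥0) < 1 / 2 by norm_num) (by norm_num)
  have hMm : M ≤ m := by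
    by_contra! hlt
    have h1 : (1 / 2 : ℝ≥0) ^ (M + 1) ≤ (1 / 2) ^ (m + 1) :=
      pow_le_pow_of_le_one (by norm_num) (by norm_num) (by omega)
    exact absurd (hδ.trans_le h1) hm1.le.not_gt
  have hN : ENNReal.ofReal ((2 ^ m) ^ d / K) ≤ (Metric.coveringNumber δ A : ℝ≥0∞) :=
    (hM m hMm).trans (by exact_mod_cast Metric.coveringNumber_anti hm2)
  refine le_trans ?_ (ENNReal.log_le_log hN)
  rw [ENNReal.log_ofReal_of_pos (by positivity)]
  rw [div_le_iff₀ (by linarith)] at hl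
  have hδm : Real.log (1 / (δ : ℝ)) ≤ (m + 1) * Real.log 2 := by
    have h1 : ((1 / 2 : ℝ)) ^ (m + 1) < δ := by exact_mod_cast hm1
    rw [one_div, Real.log_inv]
    have h2 := Real.log_le_log (by positivity) h1.le
    rw [one_div, inv_pow, Real.log_inv, Real.log_pow] at h2
    push_cast at h2
    linarith
  have hlogN : Real.log ((2 ^ m) ^ d / K) = d * (m * Real.log 2) - Real.log K := by
    rw [Real.log_div (by positivity) (by positivity), Real.log_rpow (by positivity), Real.log_pow]
  rw [hlogN, ← EReal.coe_mul]
  exact EReal.coe_le_coe_iff.2 (by nlinarith)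

theorem lowerBoxDim_le_of_frequently {X : Type*} [PseudoMetricSpace X] {A : Set X} {s : ℝ}
    (h : ∃ᶠ m : ℕ in atTop,
      (Metric.coveringNumber ((1 / 2 : ℝ≥0) ^ m) A : ℝ≥0∞) ≤ ENNReal.ofReal ((2 ^ m) ^ s)) :
    lowerBoxDim A ≤ ENNReal.ofReal s := by
  rw [← EReal.toENNReal_coe_real, lowerBoxDim]
  refine EReal.toENNReal_le_toENNReal (liminf_le_of_frequently_le' ?_)
  refine tendsto_half_pow_nhdsGT_zero.frequently ?_
  refine (h.and_eventually (eventually_gt_atTop 0)).mono ?_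
  rintro m ⟨hm, hm0⟩
  have hm0 : (0 : ℝ) < m := by exact_mod_cast hm0
  have hl : Real.log (1 / (((1 / 2 : ℝ≥0) ^ m : ℝ≥0) : ℝ)) = m * Real.log 2 := by
    push_cast
    rw [one_div, ← inv_pow, one_div, inv_inv, Real.log_pow]
  rw [hl, EReal.div_le_iff_le_mul (by exact_mod_cast mul_pos hm0 (Real.log_pos one_lt_two))
    (EReal.coe_ne_top _)]
  refine (ENNReal.log_le_log hm).trans ?_
  rw [ENNReal.log_ofReal_of_pos (by positivity), Real.log_rpow (by positivity), Real.log_pow]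
  norm_cast
  linarith

/-! ### Mixed cells and covering numbers -/

namespace Sierpinski

/-- The integer position of a cell, in units of its size. -/
def cellIndex : List (Fin 3) → Fin 3 → ℤ
  | [], _ => 0
  | i :: u, k => (if k = i then 2 ^ u.length else 0) + cellIndex u k

theorem coord_cell (u : List (Fin 3)) (x : triangle) (k : Fin 3) :
    coord (cell u x) k * 2 ^ u.length = cellIndex u k + coord x k := by
  induction u with
  | nil => simp [cellIndex]
  | cons i u ih =>
    simp only [cell_cons, Function.comp_apply, coord_piece, List.length_cons, cellIndex, pow_succ]
    push_cast
    rw [add_assoc, ← ih]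
    split_ifs <;> ring

theorem cellIndex_nonneg (u : List (Fin 3)) (k : Fin 3) : 0 ≤ cellIndex u k := by
  induction u with
  | nil => simp [cellIndex]
  | cons i u ih => rw [cellIndex]; positivity

theorem cellIndex_lt (u : List (Fin 3)) (k : Fin 3) : cellIndex u k < 2 ^ u.length := by
  induction u with
  | nil => simp [cellIndex]
  | cons i u ih =>
    rw [cellIndex, List.length_cons, pow_succ]
    have : (0 : ℤ) < 2 ^ u.length := by positivity
    split_ifs <;> linarith

theorem cellIndex_injective {u v : List (Fin 3)} (hl : u.length = v.length)
    (h : cellIndex u = cellIndex v) : u = v := by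
  induction u generalizing v with
  | nil => exact (List.length_eq_zero_iff.1 hl.symm).symm
  | cons i u ih =>
    obtain _ | ⟨j, v⟩ := v
    · simp at hl
    have hl' : u.length = v.length := by simpa using hl
    have hij : i = j := by
      by_contra hij
      have h1 := congr_fun h i
      rw [cellIndex, cellIndex, if_pos rfl, if_neg hij] at h1
      have := cellIndex_nonneg u i
      have := cellIndex_lt v i
      rw [hl'] at h1
      linarith
    subst hij
    rw [ih hl']
    ext k
    have := congr_fun h k
    rw [cellIndex, cellIndex, hl'] at this
    linarith

theorem cellIndex_mem_Icc {m : ℕ} {u : List (Fin 3)} (hu : u.length = m) {x y : triangle}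
    (h : dist (cell u x) y ≤ (1 / 2) ^ m) (k : Fin 3) :
    cellIndex u k ∈ Finset.Icc (⌊coord y k * 2 ^ m⌋ - 3) (⌊coord y k * 2 ^ m⌋ + 3) := by
  have h1 : |coord (cell u x) k - coord y k| ≤ 2 * (1 / 2) ^ m := by
    rw [← Real.dist_eq]
    exact (dist_le_pi_dist _ _ k).trans ((dist_coord_le _ _).trans (by gcongr))
  have h2 := coord_cell u x k
  rw [hu] at h2
  have h3 : |cellIndex u k + coord x k - coord y k * 2 ^ m| ≤ 2 := by
    rw [← h2, ← sub_mul, abs_mul, abs_of_pos (by positivity : (0 : ℝ) < 2 ^ m)]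
    calc _ ≤ 2 * (1 / 2 : ℝ) ^ m * 2 ^ m := by gcongr
      _ = 2 := by rw [mul_assoc, ← mul_pow]; norm_num
  rw [abs_le] at h3
  have h4 := Int.floor_le (coord y k * 2 ^ m)
  have h5 := Int.lt_floor_add_one (coord y k * 2 ^ m)
  have h6 := coord_nonneg x k
  have h7 := coord_le_one x k
  have h8 : (⌊coord y k * 2 ^ m⌋ : ℝ) - 3 ≤ cellIndex u k := by linarith
  have h9 : (cellIndex u k : ℝ) < ⌊coord y k * 2 ^ m⌋ + 3 := by linarith
  rw [Finset.mem_Icc]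
  exact ⟨by exact_mod_cast h8, by exact_mod_cast h9.le⟩

/-- Each mixed cell contains a point of the level set. A ball of radius 2^(-m) meets few cells of
level `m`, as each of the three integer positions of such a cell is confined to 7 values; 343 = 7^3.
-/
theorem mixedCount_le_coveringNumber (f : C(triangle, ℝ)) (r : ℝ) (m : ℕ) :
    (mixedCount m fun x => r < f x : ℕ∞) ≤
      343 * Metric.coveringNumber ((1 / 2 : ℝ≥0) ^ m) (f ⁻¹' {r}) := by
  classical
  by_cases htop : Metric.coveringNumber ((1 / 2 : ℝ≥0) ^ m) (f ⁻¹' {r}) = ⊤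
  · rw [htop, ENat.mul_top (by norm_num)]
    exact le_top
  have hfin : (Metric.minimalCover ((1 / 2 : ℝ≥0) ^ m) (f ⁻¹' {r})).Finite :=
    Metric.finite_minimalCover
  have hcov := Metric.isCover_iff_subset_iUnion_closedBall.1 (Metric.isCover_minimalCover htop)
  rw [← Metric.encard_minimalCover htop, hfin.encard_eq_coe_toFinset_card]
  norm_cast
  rw [mul_comm]
  let box : triangle → Finset (Fin 3 → ℤ) := fun y => Fintype.piFinset fun k =>
    Finset.Icc (⌊coord y k * 2 ^ m⌋ - 3) (⌊coord y k * 2 ^ m⌋ + 3)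
  refine le_trans ?_ (Finset.card_biUnion_le_card_mul hfin.toFinset box 343 fun y _ => ?_)
  · refine Finset.card_le_card_of_injOn cellIndex (fun u hu => ?_) fun u hu v hv h => ?_
    · simp only [Finset.coe_filter, mem_words, Set.mem_ofPred_eq] at hu
      obtain ⟨hu, i, j, hi, hj⟩ := hu
      simp only [Function.comp_apply] at hi hj
      obtain ⟨x, hx⟩ := exists_eq_of_corner_le (f.continuous.comp (continuous_cell u))
        (not_lt.1 hj) hi.le
      obtain ⟨y, hy, hxy⟩ := Set.mem_iUnion₂.1 (hcov (show cell u x ∈ f ⁻¹' {r} from hx))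
      refine Finset.mem_coe.2 (Finset.mem_biUnion.2 ⟨y, hfin.mem_toFinset.2 hy, ?_⟩)
      refine Fintype.mem_piFinset.2 fun k => cellIndex_mem_Icc hu (x := x) ?_ k
      simpa using hxy
    · simp only [Finset.coe_filter, mem_words, Set.mem_ofPred_eq] at hu hv
      exact cellIndex_injective (hu.1.trans hv.1.symm) h
  · rw [Fintype.card_piFinset]
    simp only [Int.card_Icc]
    have : ∀ z : ℤ, (z + 3 + 1 - (z - 3)).toNat = 7 := fun z => by
      rw [show z + 3 + 1 - (z - 3) = 7 by ring]; rfl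
    simp [this]

end Sierpinski

/-! ### Almost every level cuts only cells with many turns -/

theorem two_rpow_neg_pow (α : ℝ) (m : ℕ) : ((2 : ℝ) ^ (-α)) ^ m = (1 / 2 ^ m) ^ α := by
  rw [one_div, ← Real.rpow_natCast, ← Real.rpow_natCast, ← Real.rpow_neg (by norm_num),
    ← Real.rpow_mul (by norm_num), ← Real.rpow_mul (by norm_num)]
  ring_nf

namespace Sierpinski

/-- The levels `r` that cut some cell of level `m` with fewer than `k` changes of letter. -/
def fewTurns (m k : ℕ) (q : Fin 3) (f : triangle → ℝ) : Set ℝ :=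
  {r | ∃ u : List (Fin 3), u.length = m ∧ Mixed ((fun x => r < f x) ∘ cell u) ∧ turns q u < k}

/-- A Chernoff bound: giving each turn the weight `t`, the words have total weight (1 + 2t)^m, since
one letter continues and two letters turn. A word with fewer than `k` turns weighs at least t^k, and
accounts for levels in an interval of length 2ω. -/
theorem volume_fewTurns_le {ω t : ℝ} (hω : 0 ≤ ω) (ht : 0 < t) (m k : ℕ) (q : Fin 3)
    (f : triangle → ℝ)
    (hf : ∀ u : List (Fin 3), u.length = m → ∀ i j,
      |f (cell u (corner i)) - f (cell u (corner j))| ≤ ω) (ht1 : t ≤ 1) :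
    volume (fewTurns m k q f) ≤ ENNReal.ofReal (2 * ω * (t⁻¹ ^ k * (1 + 2 * t) ^ m)) := by
  rcases k with _ | k
  · simp [fewTurns]
  induction m generalizing k q f with
  | zero =>
    have hsub : fewTurns 0 (k + 1) q f ⊆ Set.Icc (f (corner 0) - ω) (f (corner 0) + ω) := by
      rintro r ⟨u, hu, ⟨i, j, hi, hj⟩, -⟩
      obtain rfl := List.length_eq_zero_iff.1 hu
      simp only [cell_nil, Function.comp_apply, id, not_lt] at hi hj
      have h1 := abs_le.1 (hf [] rfl i 0)
      have h2 := abs_le.1 (hf [] rfl j 0)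
      simp only [cell_nil, id] at h1 h2
      constructor <;> linarith
    refine (measure_mono hsub).trans ?_
    rw [Real.volume_Icc]
    refine ENNReal.ofReal_le_ofReal ?_
    have h1 : (1 : ℝ) ≤ t⁻¹ ^ (k + 1) := one_le_pow₀ ((one_le_inv₀ ht).2 ht1)
    simp only [pow_zero, mul_one]
    nlinarith
  | succ m ih =>
    have hsub : fewTurns (m + 1) (k + 1) q f ⊆
        ⋃ i, fewTurns m (if i = q then k + 1 else k) i (f ∘ piece i) := by
      rintro r ⟨u, hu, hm, hk⟩
      obtain _ | ⟨i, u⟩ := u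
      · simp at hu
      · refine Set.mem_iUnion.2 ⟨i, u, by simpa using hu, hm, ?_⟩
        rw [turns] at hk
        split_ifs at hk ⊢ <;> omega
    have hpiece : ∀ i, volume (fewTurns m (if i = q then k + 1 else k) i (f ∘ piece i)) ≤
        ENNReal.ofReal (2 * ω * ((if i = q then t⁻¹ ^ (k + 1) else t⁻¹ ^ k) *
          (1 + 2 * t) ^ m)) := by
      intro i
      have hfi : ∀ u : List (Fin 3), u.length = m → ∀ a b,
          |(f ∘ piece i) (cell u (corner a)) - (f ∘ piece i) (cell u (corner b))| ≤ ω :=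
        fun u hu => hf (i :: u) (by simp [hu])
      split_ifs with h
      · exact ih i _ hfi k
      · rcases k with _ | k
        · simp [fewTurns]
        · exact ih i _ hfi k
    refine (measure_mono hsub).trans ((measure_iUnion_le _).trans ?_)
    rw [tsum_fintype]
    refine (Finset.sum_le_sum fun i _ => hpiece i).trans ?_
    rw [← ENNReal.ofReal_sum_of_nonneg fun i _ => by split_ifs <;> positivity]
    refine ENNReal.ofReal_le_ofReal (le_of_eq ?_)
    rw [← Finset.mul_sum, ← Finset.sum_mul]
    have h1 : ∑ i, (if i = q then t⁻¹ ^ (k + 1) else t⁻¹ ^ k) = t⁻¹ ^ (k + 1) * (1 + 2 * t) := by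
      have h2 : t⁻¹ ^ (k + 1) * (1 + 2 * t) = t⁻¹ ^ (k + 1) + 2 * t⁻¹ ^ k := by
        rw [pow_succ]; field_simp
      rw [h2]
      fin_cases q <;> simp [Fin.sum_univ_three] <;> ring
    rw [h1, pow_succ]
    ring

theorem ae_le_lowerBoxDim {α d : ℝ} (hα : 0 < α) (hd : 0 < d) (hd1 : d ≤ 1)
    (hρ : (2 : ℝ) ^ (-α) * (d⁻¹ ^ (2 * d) * (1 + 2 * d)) < 1) {f : C(triangle, ℝ)}
    (hf : f ∈ holderFunctions 1 α triangle) :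
    ∀ᵐ r : ℝ, Mixed (fun x => r < f x) → ENNReal.ofReal d ≤ lowerBoxDim (f ⁻¹' {r}) := by
  set ρ := (2 : ℝ) ^ (-α) * (d⁻¹ ^ (2 * d) * (1 + 2 * d)) with hρdef
  have hdi : 1 ≤ d⁻¹ := (one_le_inv₀ hd).2 hd1
  -- The extra 1 cancels the factor 2 in 2^k ≤ 2 N².
  let k : ℕ → ℕ := fun m => ⌈2 * d * m⌉₊ + 1
  have hvol : ∀ m, volume (fewTurns m (k m) 0 f) ≤ ENNReal.ofReal (2 * d⁻¹ ^ 2 * ρ ^ m) := by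
    intro m
    refine (volume_fewTurns_le (ω := ((2 : ℝ) ^ (-α)) ^ m) (t := d) (by positivity) hd m (k m) 0 f
      (fun u hu i j => ?_) hd1).trans (ENNReal.ofReal_le_ofReal ?_)
    · refine (hf _ _).trans ?_
      rw [one_mul, dist_cell, hu, two_rpow_neg_pow]
      gcongr
      exact dist_le_one _ _
    · have h1 : d⁻¹ ^ (k m) ≤ d⁻¹ ^ 2 * (d⁻¹ ^ (2 * d)) ^ m := by
        rw [← Real.rpow_natCast, ← Real.rpow_natCast, ← Real.rpow_natCast,
          ← Real.rpow_mul (by positivity), ← Real.rpow_add (by positivity)]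
        refine Real.rpow_le_rpow_of_exponent_le hdi ?_
        have := Nat.ceil_lt_add_one (by positivity : 0 ≤ 2 * d * m)
        push_cast [k]
        linarith
      calc 2 * ((2 : ℝ) ^ (-α)) ^ m * (d⁻¹ ^ k m * (1 + 2 * d) ^ m)
          ≤ 2 * ((2 : ℝ) ^ (-α)) ^ m * (d⁻¹ ^ 2 * (d⁻¹ ^ (2 * d)) ^ m * (1 + 2 * d) ^ m) := by
            gcongr
        _ = 2 * d⁻¹ ^ 2 * ρ ^ m := by rw [hρdef, mul_pow, mul_pow]; ring
  have hsum : ∑' m, volume (fewTurns m (k m) 0 f) ≠ ⊤ := by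
    refine ne_top_of_le_ne_top ?_ (ENNReal.tsum_le_tsum hvol)
    exact ((summable_geometric_of_lt_one (by positivity) hρ).mul_left _).tsum_ofReal_ne_top
  filter_upwards [ae_eventually_notMem hsum] with r hr hmix
  refine le_lowerBoxDim_of_eventually hd (K := 343) (by norm_num) ?_
  filter_upwards [hr] with m hm
  have h1 := (two_pow_le_mixedCount m (fun x => r < f x) 0 (k m) hmix fun u hu hmu => by
    by_contra! hlt
    exact hm ⟨u, hu, hmu, hlt⟩).1
  set N := mixedCount m fun x => r < f x
  have h2 : (2 : ℝ) ^ ⌈2 * d * m⌉₊ ≤ N ^ 2 := by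
    rw [pow_succ] at h1
    have : 2 ^ ⌈2 * d * m⌉₊ ≤ N ^ 2 := by omega
    exact_mod_cast this
  have h3 : ((2 : ℝ) ^ m) ^ d ≤ N := by
    refine le_of_sq_le_sq (le_trans ?_ h2) (by positivity)
    rw [← Real.rpow_natCast, ← Real.rpow_natCast, ← Real.rpow_natCast,
      ← Real.rpow_mul (by positivity), ← Real.rpow_mul (by positivity)]
    refine Real.rpow_le_rpow_of_exponent_le one_le_two ?_
    refine le_trans (le_of_eq ?_) (Nat.le_ceil _)
    push_cast; ring
  have h4 : (N : ℝ≥0∞) ≤ 343 * (Metric.coveringNumber ((1 / 2 : ℝ≥0) ^ m) (f ⁻¹' {r}) : ℝ≥0∞) := by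
    exact_mod_cast ENat.toENNReal_le.2 (mixedCount_le_coveringNumber f r m)
  rw [ENNReal.ofReal_div_of_pos (by norm_num)]
  refine ENNReal.div_le_of_le_mul' ?_
  refine le_trans (ENNReal.ofReal_le_ofReal h3) ?_
  rw [ENNReal.ofReal_natCast]
  simpa using h4

/-- Write D for the denominator, so that α log 2 = 2d · D log 2. Since log (1 + 2d) ≤ 2d, it
suffices that log (1/d) + 1 < D log 2. As 1/d = 2 (D/3)(3/α), this amounts to D < 3 · 2^(2/α). -/
theorem growth_lt_one {α : ℝ} (hα0 : 0 < α) (hα1 : α < 1) {d : ℝ}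
    (hd : d = (α / 2) / (1 + (1 + Real.log (3 / α)) / Real.log 2 + 2 / α)) :
    0 < d ∧ d ≤ 1 ∧ (2 : ℝ) ^ (-α) * (d⁻¹ ^ (2 * d) * (1 + 2 * d)) < 1 := by
  have hL := Real.log_two_gt_d9
  have hL0 : 0 < Real.log 2 := by linarith
  have hx0 : 0 ≤ Real.log (3 / α) := Real.log_nonneg ((one_le_div hα0).2 (by linarith))
  have hx1 : Real.log (3 / α) ≤ 3 / α - 1 := Real.log_le_sub_one_of_pos (by positivity)
  set x := Real.log (3 / α)
  set D := 1 + (1 + x) / Real.log 2 + 2 / α with hD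
  have hD1 : 1 ≤ D := by
    have : 0 ≤ (1 + x) / Real.log 2 := by positivity
    have : 0 ≤ 2 / α := by positivity
    linarith
  have hd0 : 0 < d := by rw [hd]; positivity
  have hdα : d * D = α / 2 := by rw [hd]; field_simp
  have hd1 : d ≤ 1 := by nlinarith
  refine ⟨hd0, hd1, ?_⟩
  have hDL : D * Real.log 2 = Real.log 2 + 1 + x + 2 / α * Real.log 2 := by
    rw [hD]; field_simp; ring
  have hα' : 1 < 1 / α := (one_lt_div hα0).2 hα1
  -- Here D ≤ 1 + 6.4/α, while Bernoulli's inequality gives 3 · 4^(1/α) ≥ 3 + 9/α.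
  have hDlt : D < 3 * (2 : ℝ) ^ (2 / α) := by
    have h1 : (1 + x) / Real.log 2 ≤ 4.4 * (1 / α) := by
      rw [div_le_iff₀ hL0]
      have : 3 / α = 3 * (1 / α) := by ring
      nlinarith
    have h2 : 1 + 1 / α * 3 ≤ (1 + 3 : ℝ) ^ (1 / α) :=
      one_add_mul_self_le_rpow_one_add (by norm_num) hα'.le
    have h3 : (2 : ℝ) ^ (2 / α) = (1 + 3 : ℝ) ^ (1 / α) := by
      rw [show (1 + 3 : ℝ) = 2 ^ (2 : ℝ) by norm_num, ← Real.rpow_mul (by norm_num)]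
      congr 1; ring
    have h4 : 2 / α = 2 * (1 / α) := by ring
    rw [h3]
    linarith
  have hlogd : Real.log d⁻¹ < Real.log 2 + x + 2 / α * Real.log 2 := by
    have h1 : d⁻¹ = 2 * (D / 3) * (3 / α) := by
      rw [eq_comm, ← mul_eq_one_iff_eq_inv₀ hd0.ne']
      field_simp
      linarith
    have h2 : d⁻¹ < 2 * 2 ^ (2 / α) * (3 / α) := by
      rw [h1]; gcongr; linarith
    refine (Real.log_lt_log (by positivity) h2).trans_eq ?_
    rw [Real.log_mul (by positivity) (by positivity), Real.log_mul (by positivity) (by positivity),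
      Real.log_rpow (by norm_num)]
    ring
  rw [← Real.log_neg_iff (by positivity), Real.log_mul (by positivity) (by positivity),
    Real.log_mul (by positivity) (by positivity), Real.log_rpow (by positivity),
    Real.log_rpow (by positivity)]
  have h1 : Real.log (1 + 2 * d) ≤ 2 * d := by
    linarith [Real.log_le_sub_one_of_pos (by positivity : 0 < 1 + 2 * d)]
  have h2 : α * Real.log 2 = 2 * d * (D * Real.log 2) := by
    rw [← mul_assoc, mul_assoc 2 d D, hdα]; ring
  nlinarith

/-! ### The dense open set behind the lower bound -/

/-- The functions with different values at two of the corners. -/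
def separating (α : ℝ) : Set (holderFunctions 1 α triangle) :=
  {f | (f : C(triangle, ℝ)) (corner 0) ≠ (f : C(triangle, ℝ)) (corner 1)}

theorem convex_holderFunctions (c α : ℝ) : Convex ℝ (holderFunctions c α triangle) := by
  intro f hf g hg a b ha hb hab x y
  have h1 := abs_le.1 (hf x y)
  have h2 := abs_le.1 (hg x y)
  simp only [ContinuousMap.add_apply, ContinuousMap.smul_apply, smul_eq_mul]
  rw [abs_le]
  obtain rfl : b = 1 - a := by linarith
  constructor <;> nlinarith

theorem corner_ne : corner 0 ≠ corner 1 := fun h => by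
  simpa [coord_corner] using congr_fun (congr_arg coord h) 0

theorem exists_holder_separating {α : ℝ} (hα0 : 0 < α) (hα1 : α < 1) :
    ∃ g ∈ holderFunctions 1 α triangle, g (corner 0) ≠ g (corner 1) := by
  refine ⟨⟨fun x => dist x (corner 0) ^ α, ?_⟩, fun x y => ?_, ?_⟩
  · exact (continuous_id.dist continuous_const).rpow_const fun _ => Or.inr hα0.le
  · have key : ∀ x y : triangle, dist x (corner 0) ^ α - dist y (corner 0) ^ α ≤ dist x y ^ α := by
      intro x y
      have h1 : dist x (corner 0) ^ α ≤ (dist x y + dist y (corner 0)) ^ α := by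
        gcongr; exact dist_triangle _ _ _
      have h2 := Real.rpow_add_le_add_rpow (dist_nonneg (x := x) (y := y))
        (dist_nonneg (x := y) (y := corner 0)) hα0.le hα1.le
      linarith
    rw [one_mul, abs_le]
    have h1 := key x y
    have h2 := key y x
    rw [dist_comm y x] at h2
    simp only [ContinuousMap.coe_mk]
    constructor <;> linarith
  · simp only [ContinuousMap.coe_mk, dist_self, Real.zero_rpow hα0.ne']
    exact (Real.rpow_pos_of_pos (dist_pos.2 corner_ne.symm) α).ne

theorem isOpen_separating (α : ℝ) : IsOpen (separating α) :=
  isOpen_ne_fun ((continuous_eval_const _).comp continuous_subtype_val)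
    ((continuous_eval_const _).comp continuous_subtype_val)

/-- The Hölder ball is convex, so a function with equal values at the two corners can be moved
slightly towards one that separates them. -/
theorem dense_separating {α : ℝ} (hα0 : 0 < α) (hα1 : α < 1) : Dense (separating α) := by
  intro f
  by_cases hf : f ∈ separating α
  · exact subset_closure hf
  obtain ⟨g, hg, hne⟩ := exists_holder_separating hα0 hα1
  have hf : (f : C(triangle, ℝ)) (corner 0) = (f : C(triangle, ℝ)) (corner 1) := not_not.1 hf
  let t : ℕ → ℝ := fun n => 1 / ((n : ℝ) + 1)
  have ht0 : ∀ n, 0 < t n := fun n => by positivity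
  have ht1 : ∀ n, t n ≤ 1 := fun n => by
    rw [div_le_one (by positivity)]
    have : (0 : ℝ) ≤ n := n.cast_nonneg
    linarith
  have ht : Tendsto t atTop (𝓝 0) := tendsto_one_div_add_atTop_nhds_zero_nat
  let F : ℕ → holderFunctions 1 α triangle := fun n =>
    ⟨(1 - t n) • (f : C(triangle, ℝ)) + t n • g,
      convex_holderFunctions 1 α f.2 hg (by linarith [ht1 n]) (ht0 n).le (by ring)⟩
  refine mem_closure_of_tendsto (f := F) (b := atTop) ?_ (Eventually.of_forall fun n => ?_)
  · rw [tendsto_subtype_rng]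
    have : Tendsto (fun n => (1 - t n) • (f : C(triangle, ℝ)) + t n • g) atTop
        (𝓝 ((1 - 0 : ℝ) • (f : C(triangle, ℝ)) + (0 : ℝ) • g)) :=
      ((tendsto_const_nhds.sub ht).smul_const _).add (ht.smul_const _)
    simpa using this
  · intro h
    simp only [F, ContinuousMap.add_apply, ContinuousMap.smul_apply, smul_eq_mul, hf] at h
    exact hne (mul_left_cancel₀ (ht0 n).ne' (add_left_cancel h))

theorem le_levelLowerBoxDim {α d : ℝ} (hα : 0 < α) (hd : 0 < d) (hd1 : d ≤ 1)
    (hρ : (2 : ℝ) ^ (-α) * (d⁻¹ ^ (2 * d) * (1 + 2 * d)) < 1) {f : C(triangle, ℝ)}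
    (hf : f ∈ holderFunctions 1 α triangle) (hne : f (corner 0) ≠ f (corner 1)) :
    ENNReal.ofReal d ≤ levelLowerBoxDim f := by
  refine le_sSup ?_
  have hae := ae_le_lowerBoxDim hα hd hd1 hρ hf
  set I := Set.Ioo (min (f (corner 0)) (f (corner 1))) (max (f (corner 0)) (f (corner 1)))
  have hI : 0 < volume I := by
    rw [Real.volume_Ioo, ENNReal.ofReal_pos, sub_pos]
    exact min_lt_max.2 hne
  have hmix : ∀ r ∈ I, Mixed fun x => r < f x := by
    rintro r ⟨h1, h2⟩
    rcases lt_max_iff.1 h2 with h | h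
    · rcases min_lt_iff.1 h1 with h' | h'
      · exact absurd h h'.not_gt
      · exact ⟨0, 1, h, h'.not_gt⟩
    · rcases min_lt_iff.1 h1 with h' | h'
      · exact ⟨1, 0, h, h'.not_gt⟩
      · exact absurd h h'.not_gt
  refine hI.trans_le (measure_mono_ae ?_)
  filter_upwards [hae] with r hr hrI
  exact hr (hmix r hrI)

theorem le_genericLowerBoxDim {α : ℝ} (hα0 : 0 < α) (hα1 : α < 1) :
    ENNReal.ofReal ((α / 2) / (1 + (1 + Real.log (3 / α)) / Real.log 2 + 2 / α))
      ≤ genericLowerBoxDim α triangle := by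
  obtain ⟨hd0, hd1, hρ⟩ := growth_lt_one hα0 hα1 rfl
  refine le_iSup₂_of_le (separating α)
    ⟨(isOpen_separating α).isGδ, dense_separating hα0 hα1⟩ (le_iInf₂ fun f hf => ?_)
  exact le_levelLowerBoxDim hα0 hd0 hd1 hρ f.2 hf

end Sierpinski

/-! ### The singular ramp and its Hölder bound -/

/-- The `j`-th approximation of the singular function that gives the right half of every dyadic
interval the proportion `p` of its increment. -/
def ramp (p : ℝ) : ℕ → ℝ → ℝ
  | 0, t => t
  | j + 1, t => if t ≤ 1 / 2 then (1 - p) * ramp p j (2 * t) else (1 - p) + p * ramp p j (2 * t - 1)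

theorem ramp_zero_right (p : ℝ) (j : ℕ) : ramp p j 0 = 0 := by
  induction j with
  | zero => rfl
  | succ j ih => simp [ramp, ih]

theorem ramp_one_right (p : ℝ) (j : ℕ) : ramp p j 1 = 1 := by
  induction j with
  | zero => rfl
  | succ j ih =>
    rw [ramp, if_neg (by norm_num), show (2 : ℝ) * 1 - 1 = 1 by norm_num, ih]
    ring

theorem ramp_succ_half (p : ℝ) (j : ℕ) (t : ℝ) : 0 ≤ t →
    ramp p (j + 1) ((t + 1) / 2) = (1 - p) + p * ramp p j t := by
  intro ht
  rcases ht.eq_or_lt with rfl | ht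
  · rw [ramp, if_pos (by norm_num), ramp_zero_right, show (2 : ℝ) * ((0 + 1) / 2) = 1 by norm_num,
      ramp_one_right]
    ring
  · rw [ramp, if_neg (by linarith), show 2 * ((t + 1) / 2) - 1 = t by ring]

theorem ramp_succ_of_le (p : ℝ) (j : ℕ) {t : ℝ} (ht : t ≤ 1) :
    ramp p (j + 1) (t / 2) = (1 - p) * ramp p j t := by
  rw [ramp, if_pos (by linarith), show 2 * (t / 2) = t by ring]

theorem ramp_mem_Icc {p : ℝ} (hp0 : 0 ≤ p) (hp1 : p ≤ 1) (j : ℕ) {t : ℝ}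
    (ht : t ∈ Set.Icc (0 : ℝ) 1) : ramp p j t ∈ Set.Icc (0 : ℝ) 1 := by
  induction j generalizing t with
  | zero => exact ht
  | succ j ih =>
    rw [ramp]
    split_ifs with h
    · have h1 := ih (t := 2 * t) ⟨by linarith [ht.1], by linarith⟩
      constructor <;> nlinarith [h1.1, h1.2]
    · have h1 := ih (t := 2 * t - 1) ⟨by linarith, by linarith [ht.2]⟩
      constructor <;> nlinarith [h1.1, h1.2]

section Holder

variable {α : ℝ}

theorem two_rpow_neg_mul_rpow (t : ℝ) (ht : 0 ≤ t) :
    (2 : ℝ) ^ (-α) * (2 * t) ^ α = t ^ α := by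
  rw [Real.mul_rpow zero_le_two ht, ← mul_assoc, ← Real.rpow_add two_pos]
  simp

theorem half_le_two_rpow_neg (hα1 : α ≤ 1) : 1 / 2 ≤ (2 : ℝ) ^ (-α) := by
  rw [one_div, ← Real.rpow_neg_one]
  exact Real.rpow_le_rpow_of_exponent_le one_le_two (by linarith)

theorem two_rpow_neg_lt_one (hα0 : 0 < α) : (2 : ℝ) ^ (-α) < 1 :=
  Real.rpow_lt_one_of_one_lt_of_neg one_lt_two (by linarith)

/-- Halving `t` multiplies the left side by 1 - p ≤ p and the right side by p = 2^(-α). The factor 2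
makes the bound trivial for t ≥ 1/2. -/
theorem ramp_le_rpow (hα0 : 0 < α) (hα1 : α ≤ 1) (j : ℕ) {t : ℝ} (ht : t ∈ Set.Icc (0 : ℝ) 1) :
    ramp (2 ^ (-α)) j t ≤ (2 * t) ^ α := by
  have hp := half_le_two_rpow_neg hα1
  have hp1 := two_rpow_neg_lt_one hα0
  induction j generalizing t with
  | zero =>
    refine (Real.self_le_rpow_of_le_one ht.1 ht.2 hα1).trans ?_
    exact Real.rpow_le_rpow ht.1 (by linarith [ht.1]) hα0.le
  | succ j ih =>
    by_cases h : t ≤ 1 / 2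
    · rw [ramp, if_pos h]
      have hmem : 2 * t ∈ Set.Icc (0 : ℝ) 1 := ⟨by linarith [ht.1], by linarith⟩
      have h1 := ih hmem
      rw [← two_rpow_neg_mul_rpow (2 * t) hmem.1]
      have h2 := (ramp_mem_Icc (by linarith) hp1.le j hmem).1
      nlinarith
    · exact (ramp_mem_Icc (by linarith) hp1.le (j + 1) ht).2.trans
        (Real.one_le_rpow (by linarith) hα0.le)

theorem one_sub_ramp_le_rpow (hα0 : 0 < α) (hα1 : α ≤ 1) (j : ℕ) {t : ℝ}
    (ht : t ∈ Set.Icc (0 : ℝ) 1) : 1 - ramp (2 ^ (-α)) j t ≤ (2 * (1 - t)) ^ α := by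
  have hp := half_le_two_rpow_neg hα1
  have hp1 := two_rpow_neg_lt_one hα0
  induction j generalizing t with
  | zero =>
    rw [ramp]
    refine (Real.self_le_rpow_of_le_one (by linarith [ht.2]) (by linarith [ht.1]) hα1).trans ?_
    exact Real.rpow_le_rpow (by linarith [ht.2]) (by linarith [ht.2]) hα0.le
  | succ j ih =>
    by_cases h : t ≤ 1 / 2
    · have := (ramp_mem_Icc (by linarith) hp1.le (j + 1) ht).1
      have := Real.one_le_rpow (x := 2 * (1 - t)) (z := α) (by linarith) hα0.le
      linarith
    · have hmem : 2 * t - 1 ∈ Set.Icc (0 : ℝ) 1 := ⟨by linarith, by linarith [ht.2]⟩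
      rw [ramp, if_neg h, ← two_rpow_neg_mul_rpow (2 * (1 - t)) (by linarith [ht.2])]
      have h1 := ih hmem
      rw [show 1 - (2 * t - 1) = 2 * (1 - t) by ring] at h1
      nlinarith

theorem abs_ramp_sub_le (hα0 : 0 < α) (hα1 : α ≤ 1) (j : ℕ) {s t : ℝ}
    (hs : s ∈ Set.Icc (0 : ℝ) 1) (ht : t ∈ Set.Icc (0 : ℝ) 1) :
    |ramp (2 ^ (-α)) j s - ramp (2 ^ (-α)) j t| ≤ 4 * |s - t| ^ α := by
  have hp := half_le_two_rpow_neg hα1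
  have hp1 := two_rpow_neg_lt_one hα0
  induction j generalizing s t with
  | zero =>
    have h1 : |s - t| ≤ 1 := by
      rw [abs_le]; constructor <;> linarith [hs.1, hs.2, ht.1, ht.2]
    have h2 := Real.self_le_rpow_of_le_one (abs_nonneg (s - t)) h1 hα1
    have h3 : 0 ≤ |s - t| ^ α := by positivity
    simp only [ramp]
    linarith
  | succ j ih =>
    wlog hst : s ≤ t generalizing s t
    · rw [abs_sub_comm, abs_sub_comm s t]
      exact this ht hs (le_of_not_ge hst)
    by_cases h : t ≤ 1 / 2
    · have h1 := ih (s := 2 * s) (t := 2 * t) ⟨by linarith [hs.1], by linarith⟩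
        ⟨by linarith [ht.1], by linarith⟩
      rw [← mul_sub, abs_mul, abs_two] at h1
      rw [ramp, ramp, if_pos h, if_pos (hst.trans h), ← mul_sub, abs_mul,
        abs_of_pos (by linarith), ← two_rpow_neg_mul_rpow |s - t| (abs_nonneg _)]
      have h2 : 0 ≤ (2 * |s - t|) ^ α := by positivity
      nlinarith [abs_nonneg (ramp (2 ^ (-α)) j (2 * s) - ramp (2 ^ (-α)) j (2 * t))]
    -- If the points lie on both sides of 1/2, self-similarity does not apply directly: the
    -- increment is split at 1/2 and the two endpoint estimates bound its parts.
    by_cases h' : s ≤ 1 / 2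
    · have hs' : 2 * s ∈ Set.Icc (0 : ℝ) 1 := ⟨by linarith [hs.1], by linarith⟩
      have ht' : 2 * t - 1 ∈ Set.Icc (0 : ℝ) 1 := ⟨by linarith, by linarith [ht.2]⟩
      have h1 := ramp_le_rpow hα0 hα1 j ht'
      have h2 := one_sub_ramp_le_rpow hα0 hα1 j hs'
      have h3 := ramp_mem_Icc (by linarith) hp1.le j hs'
      have h4 := ramp_mem_Icc (by linarith) hp1.le j ht'
      have e1 := two_rpow_neg_mul_rpow (α := α) _ ht'.1
      have e2 := two_rpow_neg_mul_rpow (α := α) (1 - 2 * s) (by linarith [hs'.2])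
      have e3 : (2 * t - 1) ^ α ≤ (2 * (t - s)) ^ α :=
        Real.rpow_le_rpow ht'.1 (by linarith) hα0.le
      have e4 : (1 - 2 * s) ^ α ≤ (2 * (t - s)) ^ α :=
        Real.rpow_le_rpow (by linarith [hs'.2]) (by linarith) hα0.le
      have e5 : (2 * (t - s)) ^ α ≤ 2 * (t - s) ^ α := by
        rw [← two_rpow_neg_mul_rpow (t - s) (by linarith)]
        have : 0 ≤ (2 * (t - s)) ^ α := Real.rpow_nonneg (by linarith) _
        nlinarith
      rw [ramp, ramp, if_neg h, if_pos h', abs_sub_comm, abs_sub_comm s, abs_of_nonneg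
        (by linarith : 0 ≤ t - s), abs_of_nonneg (by nlinarith [h3.1, h3.2, h4.1])]
      nlinarith [h3.1, h3.2, h4.1]
    · have h1 := ih (s := 2 * s - 1) (t := 2 * t - 1) ⟨by linarith, by linarith [hs.2]⟩
        ⟨by linarith, by linarith [ht.2]⟩
      rw [show 2 * s - 1 - (2 * t - 1) = 2 * (s - t) by ring, abs_mul, abs_two] at h1
      rw [ramp, ramp, if_neg h, if_neg h', add_sub_add_left_eq_sub, ← mul_sub, abs_mul,
        abs_of_pos (by linarith), ← two_rpow_neg_mul_rpow |s - t| (abs_nonneg _)]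
      nlinarith

end Holder

/-! ### Interpolation on cells -/

namespace Sierpinski

/-- The least value at a corner. -/
def cornerMin (g : triangle → ℝ) : ℝ :=
  Finset.univ.inf' Finset.univ_nonempty fun i => g (corner i)

theorem cornerMin_le (g : triangle → ℝ) (i : Fin 3) : cornerMin g ≤ g (corner i) :=
  Finset.inf'_le _ (Finset.mem_univ i)

theorem exists_cornerMin_eq (g : triangle → ℝ) : ∃ i, cornerMin g = g (corner i) := by
  obtain ⟨i, -, h⟩ := Finset.exists_mem_eq_inf' Finset.univ_nonempty fun i => g (corner i)
  exact ⟨i, h⟩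

/-- A function with the same values as `g` at the corners and the value `cornerMin g` at the
midpoints of the sides, that rises towards each corner like a function of one coordinate. -/
def fill (p : ℝ) (j : ℕ) (g : triangle → ℝ) (x : triangle) : ℝ :=
  cornerMin g + ∑ i, (g (corner i) - cornerMin g) * ramp p j (max 0 (2 * coord x i - 1))

/-- On piece `i` the other coordinates are at most 1/2, so only one term of the sum is nonzero. -/
theorem fill_piece (p : ℝ) (j : ℕ) (g : triangle → ℝ) (i : Fin 3) (y : triangle) :
    fill p j g (piece i y) =
      cornerMin g + (g (corner i) - cornerMin g) * ramp p j (coord y i) := by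
  rw [fill, Finset.sum_eq_single i]
  · rw [coord_piece, if_pos rfl, show 2 * ((coord y i + 1) / 2) - 1 = coord y i by ring,
      max_eq_right (coord_nonneg y i)]
  · intro k _ hk
    rw [coord_piece, if_neg hk, max_eq_left (by linarith [coord_le_one y k]), ramp_zero_right,
      mul_zero]
  · simp

theorem fill_corner (p : ℝ) (j : ℕ) (g : triangle → ℝ) (i : Fin 3) :
    fill p j g (corner i) = g (corner i) := by
  conv_lhs => rw [← piece_corner_self i]
  rw [fill_piece, coord_corner, if_pos rfl, ramp_one_right]
  ring

theorem abs_fill_sub_corner_le {p : ℝ} (hp0 : 0 ≤ p) (hp1 : p ≤ 1) (j : ℕ) {g : triangle → ℝ}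
    {ω : ℝ} (hg : ∀ i k, |g (corner i) - g (corner k)| ≤ ω) (x : triangle) (l : Fin 3) :
    |fill p j g x - g (corner l)| ≤ ω := by
  obtain ⟨i, y, rfl⟩ := exists_piece_eq x
  obtain ⟨k, hk⟩ := exists_cornerMin_eq g
  have h1 := ramp_mem_Icc hp0 hp1 j ⟨coord_nonneg y i, coord_le_one y i⟩
  have h2 := cornerMin_le g i
  rw [fill_piece]
  have h3 := abs_le.1 (hg i l)
  have h4 := abs_le.1 (hg k l)
  rw [← hk] at h4
  rw [abs_le]
  constructor <;> nlinarith [h1.1, h1.2]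

/-- The constant is 3 · 4 · 2: three corners, the constant of `ramp`, and the doubling of the
coordinate. -/
theorem abs_fill_sub_le {α : ℝ} (hα0 : 0 < α) (hα1 : α ≤ 1) (j : ℕ) {g : triangle → ℝ} {ω : ℝ}
    (hg : ∀ i k, |g (corner i) - g (corner k)| ≤ ω) (x y : triangle) :
    |fill (2 ^ (-α)) j g x - fill (2 ^ (-α)) j g y| ≤ 24 * ω * dist (coord x) (coord y) ^ α := by
  have hω : 0 ≤ ω := (abs_nonneg _).trans (hg 0 0)
  obtain ⟨k, hk⟩ := exists_cornerMin_eq g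
  rw [fill, fill, add_sub_add_left_eq_sub, ← Finset.sum_sub_distrib]
  refine (Finset.abs_sum_le_sum_abs _ _).trans ?_
  have hmem : ∀ (z : triangle) (i : Fin 3), max 0 (2 * coord z i - 1) ∈ Set.Icc (0 : ℝ) 1 :=
    fun z i => ⟨le_max_left _ _, max_le zero_le_one (by linarith [coord_le_one z i])⟩
  have hi : ∀ i ∈ Finset.univ,
      |(g (corner i) - cornerMin g) * ramp (2 ^ (-α)) j (max 0 (2 * coord x i - 1)) -
        (g (corner i) - cornerMin g) * ramp (2 ^ (-α)) j (max 0 (2 * coord y i - 1))| ≤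
      8 * ω * dist (coord x) (coord y) ^ α := by
    intro i _
    rw [← mul_sub, abs_mul]
    have h1 : |g (corner i) - cornerMin g| ≤ ω := hk ▸ hg i k
    have h2 := abs_ramp_sub_le hα0 hα1 j (hmem x i) (hmem y i)
    have h3 : |max 0 (2 * coord x i - 1) - max 0 (2 * coord y i - 1)| ≤
        2 * dist (coord x) (coord y) := by
      refine (abs_max_sub_max_le_max 0 _ 0 _).trans ?_
      rw [sub_zero, abs_zero, show 2 * coord x i - 1 - (2 * coord y i - 1) =
        2 * (coord x i - coord y i) by ring, abs_mul, abs_two, ← Real.dist_eq]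
      refine max_le (by positivity) ?_
      gcongr
      exact dist_le_pi_dist _ _ i
    have h4 : |max 0 (2 * coord x i - 1) - max 0 (2 * coord y i - 1)| ^ α ≤
        2 * dist (coord x) (coord y) ^ α := by
      refine (Real.rpow_le_rpow (abs_nonneg _) h3 hα0.le).trans ?_
      rw [← two_rpow_neg_mul_rpow (dist (coord x) (coord y)) dist_nonneg]
      have := half_le_two_rpow_neg hα1
      have : 0 ≤ (2 * dist (coord x) (coord y)) ^ α := by positivity
      nlinarith
    calc _ ≤ ω * (4 * (2 * dist (coord x) (coord y) ^ α)) := by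
          gcongr
          linarith
      _ = _ := by ring
  refine (Finset.sum_le_sum hi).trans (le_of_eq ?_)
  simp
  ring

theorem eq_corner_of_piece_eq {i j : Fin 3} (hij : i ≠ j) {x y : triangle}
    (h : piece i x = piece j y) : x = corner j := by
  have h1 : ∀ k, (coord x k + if k = i then 1 else 0) / 2 =
      (coord y k + if k = j then 1 else 0) / 2 := fun k => by
    rw [← coord_piece, ← coord_piece, h]
  have hxj : coord x j = 1 := by
    have := h1 j
    rw [if_pos rfl, if_neg hij.symm] at this
    linarith [coord_nonneg y j, coord_le_one x j]
  apply coord_injective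
  ext k
  rw [coord_corner]
  split_ifs with hk
  · rw [hk, hxj]
  · have h2 := sum_coord x
    rw [← Finset.add_sum_erase _ _ (Finset.mem_univ j), hxj] at h2
    have h3 := Finset.single_le_sum (f := coord x) (fun i _ => coord_nonneg x i)
      (Finset.mem_erase.2 ⟨hk, Finset.mem_univ k⟩)
    linarith [coord_nonneg x k]

theorem piece_injective (i : Fin 3) : Function.Injective (piece i) := fun _ _ h =>
  Subtype.ext (contraction_injective i (congr_arg Subtype.val h))

/-- The function that agrees with `g` at the corners of all cells of level `n` and is given by
`fill` on each of these cells. -/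
def interp (p : ℝ) (j : ℕ) : ℕ → (triangle → ℝ) → triangle → ℝ
  | 0, g => fill p j g
  | n + 1, g => fun x =>
    interp p j n (g ∘ piece (exists_piece_eq x).choose) (exists_piece_eq x).choose_spec.choose

/-- The definition chooses a piece that contains the point. The choice matters only at a junction of
two pieces, and there both give the value of `g` because corner values are kept; hence the joint
induction. -/
theorem interp_corner (p : ℝ) (j n : ℕ) :
    (∀ g i, interp p j n g (corner i) = g (corner i)) ∧
    ∀ g i x, interp p j (n + 1) g (piece i x) = interp p j n (g ∘ piece i) x := by
  have step : ∀ n, (∀ g i, interp p j n g (corner i) = g (corner i)) →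
      ∀ g i x, interp p j (n + 1) g (piece i x) = interp p j n (g ∘ piece i) x := by
    intro n hn g i x
    have key : ∀ k y, piece k y = piece i x →
        interp p j n (g ∘ piece k) y = interp p j n (g ∘ piece i) x := by
      intro k y h
      by_cases hki : k = i
      · subst hki
        rw [piece_injective k h]
      · rw [eq_corner_of_piece_eq hki h, eq_corner_of_piece_eq (Ne.symm hki) h.symm, hn, hn]
        exact congr_arg g (piece_corner_comm _ _)
    exact key _ _ (exists_piece_eq (piece i x)).choose_spec.choose_spec
  have hcorner : ∀ g i, interp p j n g (corner i) = g (corner i) := by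
    induction n with
    | zero => exact fun g i => fill_corner p j g i
    | succ n ih =>
      intro g i
      conv_lhs => rw [← piece_corner_self i]
      rw [step n ih, ih]
      exact congr_arg g (piece_corner_self i)
  exact ⟨hcorner, step n hcorner⟩

theorem interp_cell (p : ℝ) (j : ℕ) {n : ℕ} {u : List (Fin 3)} (hu : u.length = n)
    (g : triangle → ℝ) (x : triangle) :
    interp p j n g (cell u x) = fill p j (g ∘ cell u) x := by
  induction u generalizing n g with
  | nil => subst hu; rfl
  | cons i u ih =>
    subst hu
    exact ((interp_corner p j u.length).2 g i (cell u x)).trans (ih rfl (g ∘ piece i))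

/-- Coordinates `i` and `j` of the junction are 1/2 and lie between those of the two points; the
third coordinate of the first point is at most 1/2 minus its `j`-th. In the sup metric the detour
through the junction thus costs no constant. -/
theorem dist_coord_junction_le {i j : Fin 3} (hij : i ≠ j) (x y : triangle) :
    dist (coord (piece i x)) (coord (piece i (corner j))) ≤
      dist (coord (piece i x)) (coord (piece j y)) := by
  have hρ : ∀ k, |coord (piece i x) k - coord (piece j y) k| ≤
      dist (coord (piece i x)) (coord (piece j y)) := fun k => by
    rw [← Real.dist_eq]; exact dist_le_pi_dist _ _ k
  have hi := hρ i
  have hj := hρ j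
  rw [coord_piece, coord_piece, if_pos rfl, if_neg hij] at hi
  rw [coord_piece, coord_piece, if_pos rfl, if_neg hij.symm] at hj
  set ρ := dist (coord (piece i x)) (coord (piece j y))
  have hsum := sum_coord x
  have hx := coord_nonneg x
  have hxi : coord x i + coord x j ≤ 1 := by
    rw [← hsum, ← Finset.sum_pair hij]
    exact Finset.sum_le_sum_of_subset_of_nonneg (Finset.subset_univ _) fun k _ _ => hx k
  refine (dist_pi_le_iff dist_nonneg).2 fun k => ?_
  rw [Real.dist_eq, coord_piece, coord_piece, coord_corner]
  rw [abs_le] at hi hj ⊢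
  have h1 := coord_nonneg y
  have h2 := coord_le_one y
  have h3 := coord_le_one x
  by_cases hki : k = i
  · rw [if_pos hki, if_neg (fun h => hij (hki.symm.trans h)), hki]
    constructor <;> linarith [hx i, h1 i, h2 i, h3 i]
  · by_cases hkj : k = j
    · rw [if_neg hki, if_pos hkj, hkj]
      constructor <;> linarith [hx j, h1 j, h2 j, h3 j]
    · have hk : coord x k + coord x j ≤ 1 := by
        rw [← hsum, ← Finset.sum_pair hkj]
        exact Finset.sum_le_sum_of_subset_of_nonneg (Finset.subset_univ _) fun k _ _ => hx k
      rw [if_neg hki, if_neg hkj]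
      constructor <;> linarith [hx k, h1 j]

/-- A point this close to a corner lies in the cell of level `n` at that corner. -/
theorem abs_sub_corner_le_of_holder_cells {α c : ℝ} {n : ℕ} {F : triangle → ℝ}
    (hF : ∀ u : List (Fin 3), u.length = n → ∀ x y,
      |F (cell u x) - F (cell u y)| ≤ c * dist (coord x) (coord y) ^ α)
    {a : triangle} {j : Fin 3} (ha : dist (coord a) (coord (corner j)) < (1 / 2) ^ n) :
    |F a - F (corner j)| ≤ c * (2 ^ n * dist (coord a) (coord (corner j))) ^ α := by
  induction n generalizing F a with
  | zero => simpa using hF [] rfl a (corner j)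
  | succ n ih =>
    obtain ⟨i, x, rfl⟩ := exists_piece_eq a
    have hij : i = j := by
      by_contra hij
      have h1 : |coord (piece i x) j - coord (corner j) j| < (1 / 2) ^ (n + 1) := by
        rw [← Real.dist_eq]; exact (dist_le_pi_dist _ _ j).trans_lt ha
      rw [coord_piece, coord_corner, if_pos rfl, if_neg (Ne.symm hij)] at h1
      have h2 : ((1 : ℝ) / 2) ^ (n + 1) ≤ 1 / 2 :=
        pow_le_of_le_one (by norm_num) (by norm_num) (by omega)
      linarith [(abs_lt.1 h1).1, coord_le_one x j]
    subst hij
    have h1 : dist (coord (piece i x)) (coord (corner i)) = dist (coord x) (coord (corner i)) / 2 := by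
      conv_lhs => rw [← piece_corner_self i]
      exact dist_coord_piece i x (corner i)
    rw [h1] at ha ⊢
    have h2 := ih (F := F ∘ piece i) (a := x) (fun u hu => hF (i :: u) (by simp [hu]))
      (by rw [pow_succ] at ha; linarith)
    simp only [Function.comp_apply, piece_corner_self] at h2
    rwa [pow_succ, show ∀ a b : ℝ, a * 2 * (b / 2) = a * b by intros; ring]

/-- Descend while both points share a piece. Once they separate, compare each with the junction,
which is a corner of both pieces; the factor 2 counts these two comparisons. -/
theorem abs_sub_le_of_holder_cells {α c : ℝ} (hα : 0 ≤ α) (hc : 0 ≤ c) {n : ℕ} {F : triangle → ℝ}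
    (hF : ∀ u : List (Fin 3), u.length = n → ∀ x y,
      |F (cell u x) - F (cell u y)| ≤ c * dist (coord x) (coord y) ^ α)
    {a b : triangle} (hab : dist (coord a) (coord b) < (1 / 2) ^ n) :
    |F a - F b| ≤ 2 * c * (2 ^ n * dist (coord a) (coord b)) ^ α := by
  induction n generalizing F a b with
  | zero =>
    have h1 := hF [] rfl a b
    have h2 : 0 ≤ c * dist (coord a) (coord b) ^ α := by positivity
    simp only [cell_nil, id, pow_zero, one_mul] at h1 ⊢
    linarith
  | succ n ih =>
    obtain ⟨i, x, rfl⟩ := exists_piece_eq a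
    obtain ⟨j, y, rfl⟩ := exists_piece_eq b
    have hscale : ∀ s : ℝ, 2 ^ (n + 1) * s = 2 ^ n * (2 * s) := fun s => by ring
    have hcell : ∀ i (u : List (Fin 3)), u.length = n → ∀ x y,
        |(F ∘ piece i) (cell u x) - (F ∘ piece i) (cell u y)| ≤
          c * dist (coord x) (coord y) ^ α := fun i u hu => hF (i :: u) (by simp [hu])
    by_cases hij : i = j
    · subst hij
      rw [dist_coord_piece] at hab ⊢
      have h2 := ih (hcell i) (a := x) (b := y) (by rw [pow_succ] at hab; linarith)
      rwa [hscale, mul_div_cancel₀ _ two_ne_zero]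
    · set ρ := dist (coord (piece i x)) (coord (piece j y)) with hρ
      have key : ∀ {i j : Fin 3} (x : triangle),
          dist (coord (piece i x)) (coord (piece i (corner j))) ≤ ρ →
          |F (piece i x) - F (piece i (corner j))| ≤ c * (2 ^ (n + 1) * ρ) ^ α := by
        intro i j x h
        rw [dist_coord_piece] at h
        have h2 := abs_sub_corner_le_of_holder_cells (hcell i) (a := x) (j := j)
          (by rw [pow_succ] at hab; linarith)
        refine h2.trans ?_
        rw [hscale]
        gcongr
        linarith
      have h1 := key x (dist_coord_junction_le hij x y)
      have h2 := key (i := j) (j := i) y (by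
        rw [hρ, dist_comm (coord (piece i x))]
        exact dist_coord_junction_le (Ne.symm hij) y x)
      rw [piece_corner_comm j i] at h2
      rw [abs_le] at h1 h2 ⊢
      constructor <;> linarith

end Sierpinski

/-! ### Approximation inside the Hölder ball -/

theorem exists_rpow_le_rpow_add {α κ : ℝ} (hα0 : 0 < α) (hα1 : α < 1) (hκ : 0 < κ) :
    ∃ β, α < β ∧ β ≤ 1 ∧ ∀ t ∈ Set.Icc (0 : ℝ) 1, t ^ α ≤ t ^ β + κ := by
  -- The difference t^α - t^β is at most (β - α) t^α (-log t) ≤ (β - α)/α.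
  refine ⟨min 1 (α + α * κ), lt_min hα1 (by linarith [mul_pos hα0 hκ]), min_le_left _ _, ?_⟩
  have hβ : α < min 1 (α + α * κ) := lt_min hα1 (by linarith [mul_pos hα0 hκ])
  have hβ2 : min 1 (α + α * κ) ≤ α + α * κ := min_le_right _ _
  set β := min 1 (α + α * κ)
  rintro t ⟨ht0, ht1⟩
  rcases ht0.eq_or_lt with rfl | ht0
  · rw [Real.zero_rpow hα0.ne', Real.zero_rpow (by linarith)]
    linarith
  have h1 : t ^ β = t ^ α * t ^ (β - α) := by
    rw [← Real.rpow_add ht0]; ring_nf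
  have h2 : 1 + Real.log t * (β - α) ≤ t ^ (β - α) := by
    rw [Real.rpow_def_of_pos ht0]
    linarith [Real.add_one_le_exp (Real.log t * (β - α))]
  have h3 : 0 < t ^ α := Real.rpow_pos_of_pos ht0 α
  have h4 : -(α * Real.log t) * t ^ α ≤ 1 := by
    have h5 := Real.log_le_sub_one_of_pos (inv_pos.2 h3)
    rw [Real.log_inv, Real.log_rpow ht0] at h5
    calc -(α * Real.log t) * t ^ α ≤ ((t ^ α)⁻¹ - 1) * t ^ α := by gcongr
      _ = 1 - t ^ α := by field_simp
      _ ≤ 1 := by linarith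
  have h5 : t ^ α * (-Real.log t * (β - α)) ≤ κ := by
    have hlog : 0 ≤ -Real.log t := by linarith [Real.log_nonpos ht0.le ht1]
    calc t ^ α * (-Real.log t * (β - α)) ≤ t ^ α * (-Real.log t * (α * κ)) := by
          gcongr; linarith
      _ = (-(α * Real.log t) * t ^ α) * κ := by ring
      _ ≤ 1 * κ := by gcongr
      _ = κ := one_mul κ
  rw [h1]
  nlinarith

namespace Sierpinski

instance : Nonempty triangle := ⟨corner 0⟩

/-- The inf-convolution of `f` with dist^β is β-Hölder with constant 1, as dist^β is a metric, and
is uniformly close to `f` for β near α. Multiplying by 1 - ε creates slack. -/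
theorem exists_higher_exponent_approx {α η : ℝ} (hα0 : 0 < α) (hα1 : α < 1) (hη : 0 < η)
    {f : C(triangle, ℝ)} (hf : f ∈ holderFunctions 1 α triangle) :
    ∃ β ε : ℝ, ∃ g : triangle → ℝ, α < β ∧ 0 < ε ∧ ε ≤ 1 ∧
      (∀ x y, |g x - g y| ≤ (1 - ε) * dist x y ^ β) ∧ ∀ x, |g x - f x| ≤ η := by
  obtain ⟨β, hβ, hβ1, hκ⟩ := exists_rpow_le_rpow_add hα0 hα1 (half_pos hη)
  have hlow : ∀ x y, f x - η / 2 ≤ f y + dist x y ^ β := by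
    intro x y
    have h1 := (abs_le.1 (hf x y)).2
    have h2 := hκ (dist x y) ⟨dist_nonneg, dist_le_one x y⟩
    linarith
  let h : triangle → ℝ := fun x => ⨅ y, (f y + dist x y ^ β)
  have hbdd : ∀ x, BddBelow (Set.range fun y => f y + dist x y ^ β) := fun x =>
    ⟨f x - η / 2, by rintro _ ⟨y, rfl⟩; exact hlow x y⟩
  have hle : ∀ x, h x ≤ f x := fun x => by
    have := ciInf_le (hbdd x) x
    simpa [dist_self, Real.zero_rpow (by linarith : β ≠ 0)] using this
  have hge : ∀ x, f x - η / 2 ≤ h x := fun x => le_ciInf (hlow x)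
  have hsub : ∀ x y, h x - h y ≤ dist x y ^ β := by
    intro x y
    rw [sub_le_iff_le_add]
    rw [← sub_le_iff_le_add']
    refine le_ciInf fun z => ?_
    have h1 : h x ≤ f z + dist x z ^ β := ciInf_le (hbdd x) z
    have h2 : dist x z ^ β ≤ (dist x y + dist y z) ^ β :=
      Real.rpow_le_rpow dist_nonneg (dist_triangle _ _ _) (by linarith)
    have h3 := Real.rpow_add_le_add_rpow (dist_nonneg (x := x) (y := y))
      (dist_nonneg (x := y) (y := z)) (by linarith : 0 ≤ β) hβ1
    linarith
  have hC : ∀ x, |f x| ≤ ‖f‖ := fun x => f.norm_coe_le_norm x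
  have hD : 0 < ‖f‖ + η / 2 + 1 := by positivity
  set ε := min 1 (η / 2 / (‖f‖ + η / 2 + 1)) with hε
  have hε0 : 0 < ε := lt_min one_pos (by positivity)
  have hε1 : ε ≤ 1 := min_le_left _ _
  have hε2 : ε * (‖f‖ + η / 2 + 1) ≤ η / 2 := by
    rw [← le_div_iff₀ hD]; exact min_le_right _ _
  refine ⟨β, ε, fun x => (1 - ε) * h x, hβ, hε0, hε1, fun x y => ?_, fun x => ?_⟩
  · rw [← mul_sub, abs_mul, abs_of_nonneg (by linarith)]
    refine mul_le_mul_of_nonneg_left (abs_le.2 ⟨?_, hsub x y⟩) (by linarith)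
    have := hsub y x
    rw [dist_comm] at this
    linarith
  · have h1 := hle x
    have h2 := hge x
    have h3 := abs_le.1 (hC x)
    have h4 : |h x| ≤ ‖f‖ + η / 2 := abs_le.2 ⟨by linarith, by linarith⟩
    have h5 : |ε * h x| ≤ η / 2 := by
      rw [abs_mul, abs_of_pos hε0]
      nlinarith
    rw [abs_le] at h5 ⊢
    constructor <;> linarith

/-- Write s = 2^(-n). For near points the cell constant 24 s^β, doubled at junctions and again by
the change of metric, rescales to 96 s^(β-α). For far points the interpolation error 4 s^β fits into
the slack ε. -/
theorem interp_holder {α β ε : ℝ} (hα0 : 0 < α) (hα1 : α < 1) (hβ : α < β) (hε1 : ε ≤ 1)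
    {g : triangle → ℝ} (hg : ∀ x y, |g x - g y| ≤ (1 - ε) * dist x y ^ β) {n : ℕ}
    (hn : 96 * ((1 / 2 : ℝ) ^ n) ^ (β - α) ≤ ε) (j : ℕ) :
    (∀ x, |interp (2 ^ (-α)) j n g x - g x| ≤ 2 * ((1 / 2 : ℝ) ^ n) ^ β) ∧
    ∀ x y, |interp (2 ^ (-α)) j n g x - interp (2 ^ (-α)) j n g y| ≤ dist x y ^ α := by
  have hp := half_le_two_rpow_neg hα1.le
  have hp1 := two_rpow_neg_lt_one hα0
  set p : ℝ := 2 ^ (-α) with hpdef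
  set s : ℝ := (1 / 2) ^ n with hs
  have hs0 : 0 < s := by positivity
  have hs1 : s ≤ 1 := pow_le_one₀ (by norm_num) (by norm_num)
  have hτ0 : 0 < s ^ (β - α) := Real.rpow_pos_of_pos hs0 _
  have hε0 : 0 < ε := by linarith
  have hsβ : s ^ β = s ^ (β - α) * s ^ α := by rw [← Real.rpow_add hs0]; ring_nf
  have hcell : ∀ u : List (Fin 3), u.length = n → ∀ x y,
      |g (cell u x) - g (cell u y)| ≤ s ^ β := by
    intro u hu x y
    refine (hg _ _).trans ?_
    rw [dist_cell, hu]
    calc (1 - ε) * (dist x y / 2 ^ n) ^ β ≤ 1 * (dist x y / 2 ^ n) ^ β := by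
          gcongr; linarith
      _ ≤ 1 * s ^ β := by
          have h1 : dist x y / 2 ^ n ≤ s := by
            rw [hs, one_div, inv_pow, ← one_div]
            gcongr
            exact dist_le_one x y
          exact mul_le_mul_of_nonneg_left (Real.rpow_le_rpow (by positivity) h1 (by linarith))
            zero_le_one
      _ = s ^ β := one_mul _
  have hclose : ∀ x, |interp p j n g x - g x| ≤ 2 * s ^ β := by
    intro x
    obtain ⟨u, hu, y, rfl⟩ := exists_cell_eq n x
    rw [interp_cell p j hu]
    have h1 := abs_fill_sub_corner_le (by linarith) hp1.le j (g := g ∘ cell u) (ω := s ^ β)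
      (fun i k => hcell u hu _ _) y 0
    have h2 := hcell u hu (corner 0) y
    simp only [Function.comp_apply] at h1
    rw [abs_le] at h1 h2 ⊢
    constructor <;> linarith
  refine ⟨hclose, fun x y => ?_⟩
  have hρ1 := dist_coord_le x y
  have hρ2 := dist_le_dist_coord x y
  rcases lt_or_ge (dist (coord x) (coord y)) s with hnear | hfar
  · have h1 := abs_sub_le_of_holder_cells hα0.le (c := 24 * s ^ β) (by positivity)
      (F := interp p j n g) (n := n) (fun u hu a b => by
        rw [interp_cell p j hu, interp_cell p j hu]
        exact abs_fill_sub_le hα0 hα1.le j (fun i k => hcell u hu _ _) a b) hnear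
    refine h1.trans ?_
    have h2 : (2 ^ n * dist (coord x) (coord y)) ^ α ≤ 2 * ((s ^ α)⁻¹ * dist x y ^ α) := by
      have h3 : (2 : ℝ) ^ n = s⁻¹ := by rw [hs, one_div, inv_pow, inv_inv]
      rw [h3]
      calc (s⁻¹ * dist (coord x) (coord y)) ^ α ≤ (s⁻¹ * (2 * dist x y)) ^ α := by gcongr
        _ = (2 * (s⁻¹ * dist x y)) ^ α := by ring_nf
        _ ≤ 2 * (s⁻¹ * dist x y) ^ α := by
            rw [← two_rpow_neg_mul_rpow (s⁻¹ * dist x y) (by positivity)]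
            have : 0 ≤ (2 * (s⁻¹ * dist x y)) ^ α := by positivity
            nlinarith
        _ = _ := by rw [Real.mul_rpow (by positivity) dist_nonneg, Real.inv_rpow hs0.le]
    calc 2 * (24 * s ^ β) * (2 ^ n * dist (coord x) (coord y)) ^ α
        ≤ 2 * (24 * s ^ β) * (2 * ((s ^ α)⁻¹ * dist x y ^ α)) := by gcongr
      _ = 96 * s ^ (β - α) * dist x y ^ α := by
          rw [hsβ]
          have : s ^ α ≠ 0 := (Real.rpow_pos_of_pos hs0 _).ne'
          field_simp
          ring
      _ ≤ 1 * dist x y ^ α := by gcongr; linarith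
      _ = dist x y ^ α := one_mul _
  · have h1 := hclose x
    have h2 := hclose y
    have h3 := hg x y
    have h4 : dist x y ^ β ≤ dist x y ^ α := by
      have hpos : 0 < dist x y := by linarith
      exact Real.rpow_le_rpow_of_exponent_ge hpos (dist_le_one x y) hβ.le
    have h5 : s ^ α ≤ 2 * dist x y ^ α := by
      calc s ^ α ≤ (2 * dist x y) ^ α := Real.rpow_le_rpow hs0.le (by linarith) hα0.le
        _ ≤ 2 * dist x y ^ α := by
            rw [← two_rpow_neg_mul_rpow (dist x y) dist_nonneg]
            have : 0 ≤ (2 * dist x y) ^ α := by positivity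
            nlinarith
    have h6 : 4 * s ^ β ≤ ε * dist x y ^ α := by
      rw [hsβ]
      have h7 : 0 ≤ dist x y ^ α := by positivity
      calc 4 * (s ^ (β - α) * s ^ α) ≤ 4 * (s ^ (β - α) * (2 * dist x y ^ α)) := by gcongr
        _ = (8 * s ^ (β - α)) * dist x y ^ α := by ring
        _ ≤ ε * dist x y ^ α := by gcongr; linarith
    have h8 : (1 - ε) * dist x y ^ β ≤ (1 - ε) * dist x y ^ α := by
      gcongr
    rw [abs_le] at h1 h2 h3 ⊢
    constructor <;> linarith

/-- The order of the quantifiers matters: `n` and `g` do not depend on `j`, so `j` may later be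
taken large compared with `n`. -/
theorem exists_interp_approx {α η : ℝ} (hα0 : 0 < α) (hα1 : α < 1) (hη : 0 < η)
    {f : C(triangle, ℝ)} (hf : f ∈ holderFunctions 1 α triangle) :
    ∃ (n : ℕ) (g : triangle → ℝ), (∀ x y, |g x - g y| ≤ 1) ∧
      ∀ j, ∃ F ∈ holderFunctions 1 α triangle, (∀ x, |F x - f x| ≤ η) ∧
        ⇑F = interp (2 ^ (-α)) j n g := by
  obtain ⟨β, ε, g, hβ, hε0, hε1, hg, hgf⟩ := exists_higher_exponent_approx hα0 hα1 (half_pos hη) hf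
  have hlim : ∀ γ : ℝ, 0 < γ → Tendsto (fun n : ℕ => ((1 / 2 : ℝ) ^ n) ^ γ) atTop (𝓝 0) := by
    intro γ hγ
    have h1 : Tendsto (fun n : ℕ => (1 / 2 : ℝ) ^ n) atTop (𝓝 0) :=
      tendsto_pow_atTop_nhds_zero_of_lt_one (by norm_num) (by norm_num)
    simpa [Real.zero_rpow hγ.ne'] using h1.rpow_const (Or.inr hγ.le : (0 : ℝ) ≠ 0 ∨ 0 ≤ γ)
  have e1 := ((hlim (β - α) (by linarith)).const_mul 96).eventually_le_const
    (by simpa using hε0 : 96 * 0 < ε)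
  have e2 := ((hlim β (by linarith)).const_mul 2).eventually_le_const
    (by simpa using half_pos hη : 2 * 0 < η / 2)
  obtain ⟨n, hn1, hn2⟩ := (e1.and e2).exists
  refine ⟨n, g, fun x y => (hg x y).trans ?_, fun j => ?_⟩
  · have h1 : dist x y ^ β ≤ 1 := Real.rpow_le_one dist_nonneg (dist_le_one x y) (by linarith)
    have h2 : 0 ≤ dist x y ^ β := by positivity
    nlinarith
  obtain ⟨hclose, hhol⟩ := interp_holder hα0 hα1 hβ hε1 hg hn1 j
  have hcont : Continuous (interp (2 ^ (-α)) j n g) := by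
    refine continuous_iff_continuousAt.2 fun x => ?_
    refine tendsto_iff_dist_tendsto_zero.2 ?_
    have h1 : Tendsto (fun y => dist y x) (𝓝 x) (𝓝 0) :=
      tendsto_iff_dist_tendsto_zero.1 tendsto_id
    have h2 : Tendsto (fun y => dist y x ^ α) (𝓝 x) (𝓝 0) := by
      simpa [Real.zero_rpow hα0.ne'] using h1.rpow_const (Or.inr hα0.le : (0 : ℝ) ≠ 0 ∨ 0 ≤ α)
    refine squeeze_zero (fun _ => dist_nonneg) (fun y => ?_) h2
    rw [Real.dist_eq]
    exact hhol y x
  refine ⟨⟨_, hcont⟩, fun x y => by rw [one_mul]; exact hhol x y, fun x => ?_, rfl⟩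
  have h1 := hclose x
  have h2 := hgf x
  simp only [ContinuousMap.coe_mk]
  rw [abs_le] at h1 h2 ⊢
  constructor <;> linarith

/-! ### Counting the cells hit by a level of the ramp -/

/-- The range of `ramp p v.length` of the `i`-th coordinate on the cell of the word `v`. -/
def rampInterval (p : ℝ) (i : Fin 3) : List (Fin 3) → ℝ × ℝ
  | [] => (0, 1)
  | k :: v =>
    if k = i then
      ((1 - p) + p * (rampInterval p i v).1, (1 - p) + p * (rampInterval p i v).2)
    else ((1 - p) * (rampInterval p i v).1, (1 - p) * (rampInterval p i v).2)

theorem ramp_coord_cell_mem {p : ℝ} (hp0 : 0 ≤ p) (hp1 : p ≤ 1) (i : Fin 3) (v : List (Fin 3))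
    (x : triangle) :
    ramp p v.length (coord (cell v x) i) ∈ Set.Icc (rampInterval p i v).1 (rampInterval p i v).2 := by
  induction v with
  | nil => exact ⟨coord_nonneg x i, coord_le_one x i⟩
  | cons k v ih =>
    rw [cell_cons, Function.comp_apply, coord_piece, List.length_cons, rampInterval]
    by_cases h : k = i
    · rw [if_pos h, if_pos h.symm, ramp_succ_half _ _ _ (coord_nonneg _ _)]
      exact ⟨by nlinarith [ih.1], by nlinarith [ih.2]⟩
    · rw [if_neg h, if_neg (Ne.symm h), add_zero, ramp_succ_of_le _ _ (coord_le_one _ _)]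
      exact ⟨by nlinarith [ih.1], by nlinarith [ih.2]⟩

open Classical in
/-- The number of words `v` of length `j` such that `rampInterval p i v` contains `r` in its
interior. -/
def levelCount (p : ℝ) : ℕ → ℝ → ℕ
  | 0, r => if 0 < r ∧ r < 1 then 1 else 0
  | j + 1, r => 2 * levelCount p j (r / (1 - p)) + levelCount p j ((r - (1 - p)) / p)

open Classical in
theorem card_rampInterval_eq {p : ℝ} (hp0 : 0 < p) (hp1 : p < 1) (i : Fin 3) (j : ℕ) (r : ℝ) :
    ((words j).filter fun v => (rampInterval p i v).1 < r ∧ r < (rampInterval p i v).2).card =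
      levelCount p j r := by
  induction j generalizing r with
  | zero =>
    rw [words, Finset.filter_singleton, levelCount, rampInterval]
    split_ifs <;> rfl
  | succ j ih =>
    rw [card_filter_words_succ, levelCount, ← ih, ← ih]
    have h1 : ∀ k, ((words j).filter fun v => (rampInterval p i (k :: v)).1 < r ∧
        r < (rampInterval p i (k :: v)).2).card =
        if k = i then ((words j).filter fun v => (rampInterval p i v).1 < (r - (1 - p)) / p ∧
          (r - (1 - p)) / p < (rampInterval p i v).2).card
        else ((words j).filter fun v => (rampInterval p i v).1 < r / (1 - p) ∧
          r / (1 - p) < (rampInterval p i v).2).card := by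
      intro k
      have hq : 0 < 1 - p := by linarith
      split_ifs with h
      · congr 1
        refine Finset.filter_congr fun v _ => ?_
        rw [rampInterval, if_pos h, lt_div_iff₀ hp0, div_lt_iff₀ hp0]
        constructor <;> rintro ⟨h1, h2⟩ <;> constructor <;> linarith
      · congr 1
        refine Finset.filter_congr fun v _ => ?_
        rw [rampInterval, if_neg h, lt_div_iff₀ hq, div_lt_iff₀ hq]
        constructor <;> rintro ⟨h1, h2⟩ <;> constructor <;> linarith
    simp only [h1]
    fin_cases i <;> simp [Fin.sum_univ_three] <;> ring

theorem levelCount_eq_zero {p : ℝ} (hp0 : 0 < p) (hp1 : p < 1) (j : ℕ) {r : ℝ}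
    (hr : r ≤ 0 ∨ 1 ≤ r) : levelCount p j r = 0 := by
  have hq : 0 < 1 - p := by linarith
  induction j generalizing r with
  | zero =>
    rw [levelCount, if_neg]
    rintro ⟨h1, h2⟩
    rcases hr with h | h <;> linarith
  | succ j ih =>
    rw [levelCount, ih, ih]
    · rcases hr with h | h
      · exact Or.inl (div_nonpos_of_nonpos_of_nonneg (by linarith) hp0.le)
      · exact Or.inr ((one_le_div hp0).2 (by linarith))
    · rcases hr with h | h
      · exact Or.inl (div_nonpos_of_nonpos_of_nonneg h hq.le)
      · exact Or.inr ((one_le_div hq).2 (by linarith))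

theorem volume_preimage_affine (a : ℝ) {b : ℝ} (hb : 0 < b) (S : Set ℝ) :
    volume ((fun r => (r - a) / b) ⁻¹' S) = ENNReal.ofReal b * volume S := by
  have h1 : (fun r => (r - a) / b) ⁻¹' S = (fun r => r + -a) ⁻¹' ((fun r => r * b⁻¹) ⁻¹' S) := by
    ext r
    simp [div_eq_mul_inv, sub_eq_add_neg]
  rw [h1, measure_preimage_add_right, Real.volume_preimage_mul_right (inv_ne_zero hb.ne'), inv_inv,
    abs_of_pos hb]

/-- At each step the count doubles if `r` falls in the lower part, of proportion 1 - p, and is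
unchanged in the upper part. So its binary logarithm is binomial for uniform `r`, and this is the
Chernoff bound with generating function (p + (1 - p) t)^j. -/
theorem volume_levelCount_ge_le {p t : ℝ} (hp0 : 0 < p) (hp1 : p < 1) (ht : 1 < t) (j : ℕ) (x : ℝ) :
    volume {r | (2 : ℝ) ^ x ≤ levelCount p j r} ≤
      ENNReal.ofReal (t ^ (-x) * (p + (1 - p) * t) ^ j) := by
  have hq : 0 < 1 - p := by linarith
  have ht0 : 0 < t := by linarith
  induction j generalizing x with
  | zero =>
    rcases le_or_gt x 0 with hx | hx
    · have hsub : {r | (2 : ℝ) ^ x ≤ levelCount p 0 r} ⊆ Set.Ioo 0 1 := by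
        intro r hr
        by_contra hcon
        simp only [Set.mem_ofPred_eq, levelCount] at hr
        rw [if_neg (show ¬ (0 < r ∧ r < 1) from hcon)] at hr
        have : (0 : ℝ) < 2 ^ x := by positivity
        norm_num at hr
        linarith
      refine (measure_mono hsub).trans ?_
      rw [Real.volume_Ioo]
      refine ENNReal.ofReal_le_ofReal ?_
      have := Real.one_le_rpow ht.le (by linarith : 0 ≤ -x)
      simpa using this
    · have hsub : {r | (2 : ℝ) ^ x ≤ levelCount p 0 r} = ∅ := by
        ext r
        have h1 : (1 : ℝ) < 2 ^ x := Real.one_lt_rpow one_lt_two hx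
        simp only [Set.mem_ofPred_eq, levelCount, Set.mem_empty_iff_false, iff_false, not_le]
        refine lt_of_le_of_lt ?_ h1
        split_ifs <;> simp
      rw [hsub, measure_empty]
      exact zero_le
  | succ j ih =>
    have hsub : {r | (2 : ℝ) ^ x ≤ levelCount p (j + 1) r} ⊆
        (fun r => (r - 0) / (1 - p)) ⁻¹' {r | (2 : ℝ) ^ (x - 1) ≤ levelCount p j r} ∪
        (fun r => (r - (1 - p)) / p) ⁻¹' {r | (2 : ℝ) ^ x ≤ levelCount p j r} := by
      intro r hr
      simp only [Set.mem_ofPred_eq, levelCount, Nat.cast_add, Nat.cast_mul, Nat.cast_ofNat] at hr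
      rcases le_total r (1 - p) with h | h
      · left
        rw [levelCount_eq_zero hp0 hp1 j (r := (r - (1 - p)) / p)
          (Or.inl (div_nonpos_of_nonpos_of_nonneg (by linarith) hp0.le))] at hr
        simp only [Set.mem_preimage, Set.mem_ofPred_eq, sub_zero]
        rw [Real.rpow_sub_one two_ne_zero]
        norm_num at hr
        linarith
      · right
        rw [levelCount_eq_zero hp0 hp1 j (r := r / (1 - p)) (Or.inr ((one_le_div hq).2 h))] at hr
        simp only [Set.mem_preimage, Set.mem_ofPred_eq]
        norm_num at hr
        linarith
    refine (measure_mono hsub).trans ((measure_union_le _ _).trans ?_)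
    rw [volume_preimage_affine 0 hq, volume_preimage_affine (1 - p) hp0]
    refine (add_le_add (mul_le_mul_right (ih (x - 1)) _) (mul_le_mul_right (ih x) _)).trans ?_
    rw [← ENNReal.ofReal_mul hq.le, ← ENNReal.ofReal_mul hp0.le,
      ← ENNReal.ofReal_add (by positivity) (by positivity)]
    refine ENNReal.ofReal_le_ofReal (le_of_eq ?_)
    rw [show -(x - 1) = -x + 1 by ring, Real.rpow_add_one ht0.ne', pow_succ]
    ring

/-! ### Cells hit by perturbed functions -/

open Classical in
/-- The number of cells of level `m` in which `f` has the value `r`. -/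
def hitCount (m : ℕ) (f : triangle → ℝ) (r : ℝ) : ℕ :=
  ((words m).filter fun u => ∃ x, f (cell u x) = r).card

theorem sum_words_add {M : Type*} [AddCommMonoid M] (n k : ℕ) (F : List (Fin 3) → M) :
    ∑ u ∈ words (n + k), F u = ∑ u ∈ words n, ∑ v ∈ words k, F (u ++ v) := by
  induction n generalizing F with
  | zero => simp [words]
  | succ n ih =>
    rw [show n + 1 + k = n + k + 1 by ring, sum_words_succ, sum_words_succ]
    refine Finset.sum_congr rfl fun i _ => ?_
    rw [ih]
    rfl

open Classical in
theorem hitCount_add_succ (n j : ℕ) (f : triangle → ℝ) (r : ℝ) :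
    hitCount (n + (j + 1)) f r = ∑ u ∈ words n, ∑ i,
      ((words j).filter fun v => ∃ x, f (cell u (piece i (cell v x))) = r).card := by
  rw [hitCount]
  simp only [Finset.card_filter]
  rw [sum_words_add]
  refine Finset.sum_congr rfl fun u _ => ?_
  rw [sum_words_succ]
  refine Finset.sum_congr rfl fun i _ => Finset.sum_congr rfl fun v _ => ?_
  simp only [cell_append, cell_cons, Function.comp_apply]

theorem coveringNumber_le_hitCount (f : C(triangle, ℝ)) (r : ℝ) (m : ℕ) :
    Metric.coveringNumber ((1 / 2 : ℝ≥0) ^ m) (f ⁻¹' {r}) ≤ hitCount m f r := by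
  classical
  let pt : List (Fin 3) → triangle := fun u =>
    -- The default is never used: only words of cells that are hit enter the cover.
    if h : ∃ x, f (cell u x) = r then cell u h.choose else corner 0
  have hpt : ∀ u, (∃ x, f (cell u x) = r) → ∃ x, pt u = cell u x ∧ f (cell u x) = r := by
    intro u h
    exact ⟨h.choose, dif_pos h, h.choose_spec⟩
  set H := (words m).filter fun u => ∃ x, f (cell u x) = r with hH
  have hcov : Metric.IsCover ((1 / 2 : ℝ≥0) ^ m) (f ⁻¹' {r}) (H.image pt : Finset triangle) := by
    rw [Metric.isCover_iff_subset_iUnion_closedBall]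
    intro z hz
    obtain ⟨u, hu, x, rfl⟩ := exists_cell_eq m z
    have hx : ∃ x, f (cell u x) = r := ⟨x, hz⟩
    have huH : u ∈ H := Finset.mem_filter.2 ⟨mem_words.2 hu, hx⟩
    refine Set.mem_iUnion₂.2 ⟨pt u, Finset.mem_coe.2 (Finset.mem_image_of_mem _ huH), ?_⟩
    obtain ⟨y, hy, -⟩ := hpt u hx
    rw [hy, Metric.mem_closedBall, dist_cell, hu]
    push_cast
    rw [one_div, inv_pow, ← one_div]
    gcongr
    exact dist_le_one _ _
  have hsub : ((H.image pt : Finset triangle) : Set triangle) ⊆ f ⁻¹' {r} := by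
    intro z hz
    obtain ⟨u, hu, rfl⟩ := Finset.mem_image.1 (Finset.mem_coe.1 hz)
    obtain ⟨y, hy, hyr⟩ := hpt u (Finset.mem_filter.1 hu).2
    rw [hy]
    exact hyr
  refine (hcov.coveringNumber_le_encard hsub).trans ?_
  rw [Set.encard_coe_eq_coe_finsetCard, hitCount]
  exact_mod_cast Finset.card_image_le

/-- The levels at distance at most `η` from the value of an approximating function at an endpoint
of an interval of the construction. -/
def nearEndpoints (p η : ℝ) (n j : ℕ) (g : triangle → ℝ) : Set ℝ :=
  ⋃ u ∈ words n, ⋃ i, ⋃ v ∈ words j,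
    Metric.closedBall (cornerMin (g ∘ cell u) +
        (g (cell u (corner i)) - cornerMin (g ∘ cell u)) * (rampInterval p i v).1) η ∪
      Metric.closedBall (cornerMin (g ∘ cell u) +
        (g (cell u (corner i)) - cornerMin (g ∘ cell u)) * (rampInterval p i v).2) η

theorem volume_nearEndpoints_le (p : ℝ) {η : ℝ} (hη : 0 ≤ η) (n j : ℕ) (g : triangle → ℝ) :
    volume (nearEndpoints p η n j g) ≤ ENNReal.ofReal (4 * 3 ^ (n + (j + 1)) * η) := by
  have hball : ∀ a b : ℝ, volume (Metric.closedBall a η ∪ Metric.closedBall b η) ≤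
      ENNReal.ofReal (4 * η) := by
    intro a b
    refine (measure_union_le _ _).trans ?_
    rw [Real.volume_closedBall, Real.volume_closedBall, ← ENNReal.ofReal_add (by linarith)
      (by linarith)]
    exact ENNReal.ofReal_le_ofReal (by linarith)
  calc volume (nearEndpoints p η n j g)
      ≤ ∑ u ∈ words n, ∑ i : Fin 3, ∑ v ∈ words j, ENNReal.ofReal (4 * η) := by
        refine (measure_biUnion_finset_le _ _).trans (Finset.sum_le_sum fun u _ => ?_)
        refine (measure_iUnion_le _).trans ?_
        rw [tsum_fintype]
        refine Finset.sum_le_sum fun i _ => ?_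
        exact (measure_biUnion_finset_le _ _).trans (Finset.sum_le_sum fun v _ => hball _ _)
    _ = ENNReal.ofReal (4 * 3 ^ (n + (j + 1)) * η) := by
        simp only [Finset.sum_const, card_words, Finset.card_univ, Fintype.card_fin, nsmul_eq_mul]
        rw [← mul_assoc, ← mul_assoc, ← Nat.cast_mul, ← Nat.cast_mul, ← ENNReal.ofReal_natCast,
          ← ENNReal.ofReal_mul (by positivity)]
        congr 1
        push_cast
        ring

-- If `f` takes the value `r` in a cell, the interpolant comes within η of `r` there. Since `r` is
-- farther than η from both endpoints of the corresponding interval, it lies strictly inside.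
open Classical in
theorem hitCount_le_sum_levelCount {p η : ℝ} (hp0 : 0 < p) (hp1 : p < 1) {n j : ℕ}
    {g f : triangle → ℝ} (hf : ∀ x, |f x - interp p j n g x| ≤ η) {r : ℝ}
    (hr : r ∉ nearEndpoints p η n j g) :
    hitCount (n + (j + 1)) f r ≤ ∑ u ∈ words n, ∑ i,
      levelCount p j ((r - cornerMin (g ∘ cell u)) /
        (g (cell u (corner i)) - cornerMin (g ∘ cell u))) := by
  rw [hitCount_add_succ]
  refine Finset.sum_le_sum fun u hu => Finset.sum_le_sum fun i _ => ?_
  rw [← card_rampInterval_eq hp0 hp1 i]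
  refine Finset.card_le_card fun v hv => ?_
  obtain ⟨hv, x, hx⟩ := Finset.mem_filter.1 hv
  refine Finset.mem_filter.2 ⟨hv, ?_⟩
  set a := cornerMin (g ∘ cell u) with ha
  have hA0 : 0 ≤ g (cell u (corner i)) - a := sub_nonneg.2 (cornerMin_le (g ∘ cell u) i)
  have hF : interp p j n g (cell u (piece i (cell v x))) =
      a + (g (cell u (corner i)) - a) * ramp p v.length (coord (cell v x) i) := by
    rw [interp_cell p j (mem_words.1 hu), fill_piece, mem_words.1 hv]
    rfl
  have hmem := ramp_coord_cell_mem hp0.le hp1.le i v x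
  have hfx := abs_le.1 (hf (cell u (piece i (cell v x))))
  rw [hx, hF] at hfx
  set A := g (cell u (corner i)) - a with hA
  have hnear : r ∉ Metric.closedBall (a + A * (rampInterval p i v).1) η ∪
      Metric.closedBall (a + A * (rampInterval p i v).2) η := fun h =>
    hr (Set.mem_iUnion₂.2 ⟨u, hu, Set.mem_iUnion.2 ⟨i, Set.mem_iUnion₂.2 ⟨v, hv, h⟩⟩⟩)
  simp only [Set.mem_union, Metric.mem_closedBall, Real.dist_eq, not_or, not_le] at hnear
  have h1 : A * (rampInterval p i v).1 ≤ A * ramp p v.length (coord (cell v x) i) :=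
    mul_le_mul_of_nonneg_left hmem.1 hA0
  have h2 : A * ramp p v.length (coord (cell v x) i) ≤ A * (rampInterval p i v).2 :=
    mul_le_mul_of_nonneg_left hmem.2 hA0
  have h3 : A * (rampInterval p i v).1 < r - a := by
    rcases lt_abs.1 hnear.1 with h | h <;> linarith
  have h4 : r - a < A * (rampInterval p i v).2 := by
    rcases lt_abs.1 hnear.2 with h | h <;> linarith
  have hA1 : 0 < A := by
    rcases hA0.eq_or_lt with h | h
    · rw [← h] at h3 h4; linarith
    · exact h
  rw [lt_div_iff₀ hA1, div_lt_iff₀ hA1]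
  constructor <;> linarith

theorem volume_hitCount_gt_le {p t η x : ℝ} (hp0 : 0 < p) (hp1 : p < 1) (ht : 1 < t) (hη : 0 ≤ η)
    {n j : ℕ} {g f : triangle → ℝ} (hg : ∀ x y, |g x - g y| ≤ 1)
    (hf : ∀ x, |f x - interp p j n g x| ≤ η) :
    volume {r | 3 ^ (n + 1) * (2 : ℝ) ^ x < hitCount (n + (j + 1)) f r} ≤
      ENNReal.ofReal (3 ^ (n + 1) * (t ^ (-x) * (p + (1 - p) * t) ^ j) +
        4 * 3 ^ (n + (j + 1)) * η) := by
  have ht0 : 0 < t := by linarith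
  have hq : 0 < 1 - p := by linarith
  let S : List (Fin 3) → Fin 3 → Set ℝ := fun u i =>
    {r | (2 : ℝ) ^ x ≤ levelCount p j ((r - cornerMin (g ∘ cell u)) /
      (g (cell u (corner i)) - cornerMin (g ∘ cell u)))}
  have hS : ∀ u i, volume (S u i) ≤ ENNReal.ofReal (t ^ (-x) * (p + (1 - p) * t) ^ j) := by
    intro u i
    have hA0 : 0 ≤ g (cell u (corner i)) - cornerMin (g ∘ cell u) :=
      sub_nonneg.2 (cornerMin_le (g ∘ cell u) i)
    have hA1 : g (cell u (corner i)) - cornerMin (g ∘ cell u) ≤ 1 := by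
      obtain ⟨k, hk⟩ := exists_cornerMin_eq (g ∘ cell u)
      rw [hk]
      exact (le_abs_self _).trans (hg _ _)
    rcases hA0.eq_or_lt with h | h
    -- When the increment vanishes, division by zero gives 0, where the count is 0.
    · have : S u i = ∅ := by
        ext r
        simp only [S, ← h, div_zero, levelCount_eq_zero hp0 hp1 j (Or.inl le_rfl),
          Set.mem_ofPred_eq, Nat.cast_zero, Set.mem_empty_iff_false, iff_false, not_le]
        positivity
      rw [this, measure_empty]
      exact zero_le
    · have := volume_preimage_affine (cornerMin (g ∘ cell u)) h
        {r | (2 : ℝ) ^ x ≤ levelCount p j r}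
      refine (le_of_eq this).trans ?_
      refine le_trans ?_ (volume_levelCount_ge_le hp0 hp1 ht j x)
      exact mul_le_of_le_one_left' (ENNReal.ofReal_le_one.2 hA1)
  have hsub : {r | 3 ^ (n + 1) * (2 : ℝ) ^ x < hitCount (n + (j + 1)) f r} ⊆
      (⋃ u ∈ words n, ⋃ i, S u i) ∪ nearEndpoints p η n j g := by
    intro r hr
    by_contra hcon
    rw [Set.mem_union, not_or] at hcon
    obtain ⟨h1, h2⟩ := hcon
    have h3 : (hitCount (n + (j + 1)) f r : ℝ) ≤ ∑ u ∈ words n, ∑ i,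
        (levelCount p j ((r - cornerMin (g ∘ cell u)) /
        (g (cell u (corner i)) - cornerMin (g ∘ cell u))) : ℝ) := by
      exact_mod_cast hitCount_le_sum_levelCount hp0 hp1 hf h2
    have h4 : ∑ u ∈ words n, ∑ i,
        (levelCount p j ((r - cornerMin (g ∘ cell u)) /
        (g (cell u (corner i)) - cornerMin (g ∘ cell u))) : ℝ) ≤
        ∑ u ∈ words n, ∑ i : Fin 3, (2 : ℝ) ^ x := by
      refine Finset.sum_le_sum fun u hu => Finset.sum_le_sum fun i _ => ?_
      by_contra! hlt
      exact h1 (Set.mem_iUnion₂.2 ⟨u, hu, Set.mem_iUnion.2 ⟨i, hlt.le⟩⟩)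
    have h5 : ∑ u ∈ words n, ∑ i : Fin 3, (2 : ℝ) ^ x = 3 ^ (n + 1) * (2 : ℝ) ^ x := by
      simp [card_words]; ring
    have hr : 3 ^ (n + 1) * (2 : ℝ) ^ x < hitCount (n + (j + 1)) f r := hr
    linarith
  refine (measure_mono hsub).trans ((measure_union_le _ _).trans ?_)
  rw [ENNReal.ofReal_add (by positivity) (by positivity)]
  refine add_le_add ?_ (volume_nearEndpoints_le p hη n j g)
  calc volume (⋃ u ∈ words n, ⋃ i, S u i)
      ≤ ∑ u ∈ words n, ∑ i : Fin 3, ENNReal.ofReal (t ^ (-x) * (p + (1 - p) * t) ^ j) := by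
        refine (measure_biUnion_finset_le _ _).trans (Finset.sum_le_sum fun u _ => ?_)
        refine (measure_iUnion_le _).trans ?_
        rw [tsum_fintype]
        exact Finset.sum_le_sum fun i _ => hS u i
    _ = ENNReal.ofReal (3 ^ (n + 1) * (t ^ (-x) * (p + (1 - p) * t) ^ j)) := by
        simp only [Finset.sum_const, card_words, Finset.card_univ, Fintype.card_fin, nsmul_eq_mul]
        rw [← mul_assoc, ← Nat.cast_mul, ← ENNReal.ofReal_natCast,
          ← ENNReal.ofReal_mul (by positivity)]
        congr 1
        push_cast
        ring

end Sierpinski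

/-! ### Baire category and the upper bound -/

theorem exists_exponential_tilt {p ε : ℝ} (hp0 : 0 < p) (hp1 : p < 1) (hε0 : 0 < ε) (hε1 : ε ≤ 1) :
    ∃ t : ℝ, 1 < t ∧ t ^ (-(1 - p + ε)) * (p + (1 - p) * t) < 1 := by
  -- With t = e^τ the logarithm is at most τ((1 - p)τ - ε), which is negative at τ = ε/2.
  refine ⟨Real.exp (ε / 2), Real.one_lt_exp_iff.2 (by linarith), ?_⟩
  have h1 := (abs_le.1 (Real.abs_exp_sub_one_sub_id_le (x := ε / 2)
    (by rw [abs_of_pos (by linarith)]; linarith))).2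
  have h2 : p + (1 - p) * Real.exp (ε / 2) ≤ Real.exp ((1 - p) * (ε / 2 + (ε / 2) ^ 2)) := by
    refine le_trans ?_ (Real.add_one_le_exp _)
    nlinarith
  rw [← Real.exp_mul]
  refine (mul_le_mul_of_nonneg_left h2 (Real.exp_pos _).le).trans_lt ?_
  rw [← Real.exp_add, Real.exp_lt_one_iff]
  have h3 : (1 - p) * (ε / 2) < ε := by nlinarith
  nlinarith

namespace Sierpinski

/-- The functions whose level sets, up to a set of levels of small measure, meet few cells of some
high level. -/
def sparse (α s : ℝ) (k : ℕ) : Set (holderFunctions 1 α triangle) :=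
  {f | ∃ m ≥ k, volume {r : ℝ | ((2 : ℝ) ^ m) ^ s < hitCount m (f : C(triangle, ℝ)) r} ≤
    ENNReal.ofReal ((1 / 2) ^ k)}

theorem dense_interior_sparse {α ε : ℝ} (hα0 : 0 < α) (hα1 : α < 1) (hε0 : 0 < ε) (hε1 : ε ≤ 1)
    (k : ℕ) : Dense (interior (sparse α (1 - 2 ^ (-α) + 2 * ε) k)) := by
  have hp0 : (0 : ℝ) < 2 ^ (-α) := by positivity
  have hp1 := two_rpow_neg_lt_one hα0
  set p : ℝ := 2 ^ (-α) with hp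
  obtain ⟨t, ht, hρ⟩ := exists_exponential_tilt hp0 hp1 hε0 hε1
  have ht0 : 0 < t := by linarith
  set ρ := t ^ (-(1 - p + ε)) * (p + (1 - p) * t) with hρdef
  have hq : 0 < 1 - p := by linarith
  have hρ0 : 0 ≤ ρ := by positivity
  refine Metric.dense_iff.2 fun f δ hδ => ?_
  obtain ⟨n, g, hg, hF⟩ := exists_interp_approx hα0 hα1 (half_pos hδ) f.2
  have hκ : (0 : ℝ) < (1 / 2) ^ k / 2 := by positivity
  have e1 := ((tendsto_pow_atTop_nhds_zero_of_lt_one hρ0 hρ).const_mul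
    ((3 : ℝ) ^ (n + 1))).eventually_le_const (by simp : 3 ^ (n + 1) * 0 < (1 / 2 : ℝ) ^ k / 2)
  -- The number 3^(n+1) of subcells is absorbed into 2^(εj); this uses up the second ε of the
  -- exponent.
  have e2 := (tendsto_pow_atTop_atTop_of_one_lt
    (Real.one_lt_rpow one_lt_two hε0)).eventually_ge_atTop ((3 : ℝ) ^ (n + 1))
  obtain ⟨j, ⟨hj1, hj2⟩, hj3⟩ := ((e1.and e2).and (eventually_ge_atTop k)).exists
  obtain ⟨F, hFh, hFf, hFi⟩ := hF j
  set m := n + (j + 1) with hm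
  -- With this radius the neighbourhoods of the endpoints take half of the allowed measure 2^(-k);
  -- the tail bound takes the other half.
  set η : ℝ := (1 / 2) ^ k / 2 / (4 * 3 ^ m) with hη
  have hη0 : 0 < η := by positivity
  refine ⟨⟨F, hFh⟩, ?_, ?_⟩
  · rw [Metric.mem_ball]
    refine lt_of_le_of_lt ?_ (half_lt_self hδ)
    exact (ContinuousMap.dist_le (half_pos hδ).le).2 fun x => by
      rw [Real.dist_eq]; exact hFf x
  · rw [mem_interior_iff_mem_nhds]
    refine Filter.mem_of_superset (Metric.ball_mem_nhds _ hη0) fun f' hf' => ?_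
    refine ⟨m, by omega, ?_⟩
    have hf'F : ∀ x, |(f' : C(triangle, ℝ)) x - interp p j n g x| ≤ η := by
      intro x
      rw [← hFi, ← Real.dist_eq]
      exact (ContinuousMap.dist_apply_le_dist x).trans (Metric.mem_ball.1 hf').le
    have hmain := volume_hitCount_gt_le (x := (1 - p + ε) * j) hp0 hp1 ht hη0.le hg hf'F
    refine le_trans (measure_mono fun r hr => ?_) (hmain.trans (ENNReal.ofReal_le_ofReal ?_))
    · rw [Set.mem_ofPred_eq] at hr ⊢
      refine lt_of_le_of_lt ?_ hr
      calc (3 : ℝ) ^ (n + 1) * 2 ^ ((1 - p + ε) * j)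
          ≤ (2 ^ ε) ^ j * 2 ^ ((1 - p + ε) * j) := by gcongr
        _ = 2 ^ (j * (1 - p + 2 * ε)) := by
            rw [← Real.rpow_natCast, ← Real.rpow_mul zero_le_two, ← Real.rpow_add two_pos]
            ring_nf
        _ ≤ 2 ^ (m * (1 - p + 2 * ε)) := by
            refine Real.rpow_le_rpow_of_exponent_le one_le_two ?_
            have : (j : ℝ) ≤ m := by exact_mod_cast (by omega : j ≤ m)
            gcongr
        _ = (2 ^ m) ^ (1 - p + 2 * ε) := by
            rw [← Real.rpow_natCast, ← Real.rpow_mul zero_le_two]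
    · have h1 : t ^ (-((1 - p + ε) * j)) * (p + (1 - p) * t) ^ j = ρ ^ j := by
        rw [hρdef, mul_pow, ← Real.rpow_natCast (t ^ _), ← Real.rpow_mul ht0.le, neg_mul]
      have h2 : 4 * 3 ^ m * η = (1 / 2) ^ k / 2 := by
        rw [hη]; field_simp
      rw [h1, h2]
      linarith

theorem isClosed_holderFunctions (c α : ℝ) : IsClosed (holderFunctions c α triangle) := by
  have : holderFunctions c α triangle =
      ⋂ a, ⋂ b, {f : C(triangle, ℝ) | |f a - f b| ≤ c * dist a b ^ α} := by
    ext f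
    simp [holderFunctions]
  rw [this]
  refine isClosed_iInter fun a => isClosed_iInter fun b => isClosed_le ?_ continuous_const
  exact ((continuous_eval_const a).sub (continuous_eval_const b)).abs

/-- By Borel–Cantelli almost every level meets few cells at all but finitely many of the chosen
scales. These form only a sequence tending to 0, which is enough for a lower limit. -/
theorem levelLowerBoxDim_le_of_forall_sparse {α s : ℝ} {f : holderFunctions 1 α triangle}
    (hf : ∀ k, f ∈ sparse α s k) :
    levelLowerBoxDim (f : C(triangle, ℝ)) ≤ ENNReal.ofReal s := by
  choose m hmk hm using hf
  have hsum : ∑' k, volume {r : ℝ | ((2 : ℝ) ^ m k) ^ s < hitCount (m k) (f : C(triangle, ℝ)) r}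
      ≠ ⊤ := by
    refine ne_top_of_le_ne_top ?_ (ENNReal.tsum_le_tsum hm)
    exact (summable_geometric_of_lt_one (by norm_num) (by norm_num)).tsum_ofReal_ne_top
  have hae : ∀ᵐ r : ℝ, lowerBoxDim ((f : C(triangle, ℝ)) ⁻¹' {r}) ≤ ENNReal.ofReal s := by
    filter_upwards [ae_eventually_notMem hsum] with r hr
    obtain ⟨K, hK⟩ := eventually_atTop.1 hr
    refine lowerBoxDim_le_of_frequently (frequently_atTop.2 fun M => ?_)
    refine ⟨m (max M K), (le_max_left M K).trans (hmk _), ?_⟩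
    have h1 : (hitCount (m (max M K)) (f : C(triangle, ℝ)) r : ℝ) ≤ (2 ^ m (max M K)) ^ s :=
      not_lt.1 (hK _ (le_max_right M K))
    have h2 := ENat.toENNReal_le.2
      (coveringNumber_le_hitCount (f : C(triangle, ℝ)) r (m (max M K)))
    refine h2.trans ?_
    rw [ENat.toENNReal_coe, ← ENNReal.ofReal_natCast]
    exact ENNReal.ofReal_le_ofReal h1
  refine sSup_le fun d hd => ?_
  by_contra! hlt
  refine (ne_of_gt hd) (measure_mono_null (fun r hr => ?_) (ae_iff.1 hae))
  exact not_le.2 (lt_of_lt_of_le hlt hr)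

theorem genericLowerBoxDim_le {α : ℝ} (hα0 : 0 < α) (hα1 : α < 1) :
    genericLowerBoxDim α triangle ≤ ENNReal.ofReal (1 - (2 : ℝ) ^ (-α)) := by
  refine iSup₂_le fun G hG => ?_
  obtain ⟨hGδ, hGd⟩ := hG
  have : CompleteSpace (holderFunctions 1 α triangle) :=
    (isClosed_holderFunctions 1 α).completeSpace_coe
  have : Nonempty (holderFunctions 1 α triangle) :=
    ⟨⟨0, fun a b => by simpa using Real.rpow_nonneg dist_nonneg α⟩⟩
  refine ENNReal.le_of_forall_pos_le_add fun ε hε _ => ?_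
  set ε' : ℝ := min ((ε : ℝ) / 2) 1 with hε'
  have hε0 : 0 < ε' := lt_min (half_pos (by exact_mod_cast hε)) one_pos
  -- The Hölder ball is closed in a complete space, so Baire's theorem makes the given dense G_δ set
  -- meet the residual set of functions with sparse levels.
  have hdense := hGd.inter_of_Gδ hGδ (IsGδ.iInter_of_isOpen fun k => isOpen_interior)
    (dense_iInter_of_isOpen_nat (fun k => isOpen_interior)
      (dense_interior_sparse hα0 hα1 hε0 (min_le_right _ _)))
  obtain ⟨f, hfG, hf⟩ := hdense.nonempty
  refine (iInf₂_le f hfG).trans ?_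
  refine (levelLowerBoxDim_le_of_forall_sparse
    fun k => interior_subset (Set.mem_iInter.1 hf k)).trans ?_
  refine ENNReal.ofReal_add_le.trans ?_
  gcongr
  rw [← ENNReal.ofReal_coe_nnreal]
  refine ENNReal.ofReal_le_ofReal ?_
  linarith [min_le_left ((ε : ℝ) / 2) 1]

end Sierpinski

end

theorem mainTheorem12 (α : ℝ) (hα0 : 0 < α) (hα1 : α < 1) :
    ENNReal.ofReal
        ((α / 2) / (1 + (1 + Real.log (3 / α)) / Real.log 2 + 2 / α))
      ≤ genericLowerBoxDim α Sierpinski.triangle ∧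
    genericLowerBoxDim α Sierpinski.triangle ≤ ENNReal.ofReal (1 - (2 : ℝ) ^ (-α)) :=
  ⟨Sierpinski.le_genericLowerBoxDim hα0 hα1, Sierpinski.genericLowerBoxDim_le hα0 hα1⟩
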